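/- Let $d\ge 0$, let $S\subset\mathbb Z^d$ be a finite set of voxels (for instance a rectangular grid; $v\in S$ stands for the unit cube $v+[0,1]^d$), and let $f,g:S\to\mathbb R$ be the grayscale functions of two images on $S$. From an image $f$ one makes a monotone function $\hat f$ on a finite cubical complex by one of two methods. Method 1 (voxels as top cells): the complex consists of the cubes $v+[0,1]^d$, $v\in S$, and all their faces, and $\hat f(\sigma)=\min\{f(v): v\in S,\ \sigma \text{ is a face of } v+[0,1]^d\}$. Method 2 (the dual complex, voxels as vertices): the complex consists of all elementary cubes $\prod_i I_i$ (each $I_i$ equal to $\{m\}$ or $[m,m+1]$ with $m\in\mathbb Z$) all of whose vertices lie in $S$, and $\hat f(\sigma)=\max\{f(v): v \text{ is a vertex of } \sigma\}$. Let $\hat f$ and $\hat g$ be made from $f$ and $g$ by the same method. Fix a field of coefficients. For each $k\ge 0$ let $\mathrm{Dgm}_k(\hat f)$ be the multiset of points (birth, death), death possibly $+\infty$, of the bars in the interval decomposition of the persistence module $a\mapsto H_k(\{\sigma:\hat f(\sigma)\le a\})$, with the maps induced by inclusion, and let $\mathrm{Dgm}(\hat f)=(\mathrm{Dgm}_k(\hat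 f))_{k\ge0}$; likewise for $\hat g$. For $1\le p\le\infty$ let $W_p(\mathrm{Dgm}_k(\hat f),\mathrm{Dgm}_k(\hat g))$ be the infimum, over all partial bijections between the two diagrams, of the $\ell^p$ norm of the family consisting of the $\ell^p$ distances between matched points and the $\ell^p$ distances of the unmatched points of either diagram to the diagonal (with $|\infty-\infty|=0$), and let $W_p(\mathrm{Dgm}(\hat f),\mathrm{Dgm}(\hat g))$ be the $\ell^p$ norm over $k$ of these numbers. Then these diagrams exist, and for every $p\in[1,\infty]$ $$W_p(\mathrm{Dgm}(\hat f),\mathrm{Dgm}(\hat g))\ \le\ \Big(\sum_{i=0}^{d}2^{d-i}\binom di\Big)\,\|f-g\|_p ,$$ where $\|f-g\|_p$ is the $\ell^p$ norm of $f-g$ over the voxels in $S$. -/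

import Mathlib

open scoped ENNReal

universe u

set_option maxSynthPendingDepth 3

noncomputable section

/-! ### Elementary cubes of the grid `ℤ^d` and their cellular chain complex -/

/-- The elementary cube `∏ i, [base i, base i + 1]` (for `i ∈ dirs`) `× {base i}` (for `i ∉ dirs`)
in `ℝ^d`, with vertices in `ℤ^d`. -/
@[ext] structure ElemCube (d : ℕ) where
  base : Fin d → ℤ
  dirs : Finset (Fin d)

namespace ElemCube

variable {d : ℕ}

/-- The dimension of an elementary cube. -/
def dim (σ : ElemCube d) : ℕ := σ.dirs.card

/-- The vertex `{v}`. -/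
def vertex (v : Fin d → ℤ) : ElemCube d := ⟨v, ∅⟩

/-- The `d`-dimensional cube with lowest corner `v`. -/
def voxel (v : Fin d → ℤ) : ElemCube d := ⟨v, Finset.univ⟩

/-- `τ` is a face (of any codimension, including `0`) of `σ`. -/
def IsFace (τ σ : ElemCube d) : Prop :=
  τ.dirs ⊆ σ.dirs ∧ ∀ i, τ.base i = σ.base i ∨
    (i ∈ σ.dirs ∧ i ∉ τ.dirs ∧ τ.base i = σ.base i + 1)

theorem IsFace.trans {ρ τ σ : ElemCube d} (h₁ : ρ.IsFace τ) (h₂ : τ.IsFace σ) : ρ.IsFace σ := by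
  refine ⟨h₁.1.trans h₂.1, fun i => ?_⟩
  have a := h₁.2 i
  have b := h₂.2 i
  have c := @h₁.1 i
  have e := @h₂.1 i
  grind

/-- The facet of `σ` on the lower side in direction `i`. -/
def lower (σ : ElemCube d) (i : Fin d) : ElemCube d := ⟨σ.base, σ.dirs.erase i⟩

/-- The facet of `σ` on the upper side in direction `i`. -/
def upper (σ : ElemCube d) (i : Fin d) : ElemCube d := ⟨σ.base + Pi.single i 1, σ.dirs.erase i⟩

/-- The incidence sign of the two facets of `σ` in direction `i`. -/
def sign (𝕜 : Type*) [Field 𝕜] (σ : ElemCube d) (i : Fin d) : 𝕜 :=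
  (-1) ^ (σ.dirs.filter (· < i)).card

/-- The cellular boundary `∂σ = ∑ i ∈ dirs, ± (upper facet - lower facet)`, extended linearly. -/
def boundary (𝕜 : Type*) [Field 𝕜] (d : ℕ) : (ElemCube d →₀ 𝕜) →ₗ[𝕜] (ElemCube d →₀ 𝕜) :=
  Finsupp.linearCombination 𝕜 fun σ : ElemCube d =>
    ∑ i ∈ σ.dirs, σ.sign 𝕜 i • (Finsupp.single (σ.upper i) 1 - Finsupp.single (σ.lower i) 1)

variable (𝕜 : Type*) [Field 𝕜]

/-- The `k`-chains of a set of cubes. -/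
def chains (X : Set (ElemCube d)) (k : ℕ) : Submodule 𝕜 (ElemCube d →₀ 𝕜) :=
  Finsupp.supported 𝕜 𝕜 {σ | σ ∈ X ∧ σ.dim = k}

/-- The `k`-cycles of a set of cubes. -/
def cycles (X : Set (ElemCube d)) (k : ℕ) : Submodule 𝕜 (ElemCube d →₀ 𝕜) :=
  chains 𝕜 X k ⊓ LinearMap.ker (boundary 𝕜 d)

/-- The `k`-boundaries of a set of cubes. -/
def boundaries (X : Set (ElemCube d)) (k : ℕ) : Submodule 𝕜 (ElemCube d →₀ 𝕜) :=
  (chains 𝕜 X (k + 1)).map (boundary 𝕜 d)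

/-- Cellular homology in degree `k`, with coefficients in `𝕜`, of a subcomplex `X` of the grid. -/
abbrev Homology (X : Set (ElemCube d)) (k : ℕ) :=
  cycles 𝕜 X k ⧸ (boundaries 𝕜 X k).comap (cycles 𝕜 X k).subtype

theorem chains_mono {X Y : Set (ElemCube d)} (h : X ⊆ Y) (k : ℕ) : chains 𝕜 X k ≤ chains 𝕜 Y k :=
  Finsupp.supported_mono fun _ hσ => ⟨h hσ.1, hσ.2⟩

theorem cycles_mono {X Y : Set (ElemCube d)} (h : X ⊆ Y) (k : ℕ) : cycles 𝕜 X k ≤ cycles 𝕜 Y k :=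
  inf_le_inf_right _ (chains_mono 𝕜 h k)

/-- The map induced in homology by an inclusion. -/
def homologyMap {X Y : Set (ElemCube d)} (h : X ⊆ Y) (k : ℕ) :
    Homology 𝕜 X k →ₗ[𝕜] Homology 𝕜 Y k :=
  Submodule.mapQ _ _ (Submodule.inclusion (cycles_mono 𝕜 h k)) fun _ hx =>
    Submodule.map_mono (chains_mono 𝕜 h (k + 1)) hx

end ElemCube

/-! ### Persistence modules, interval decompositions, and the Wasserstein distance -/

/-- A persistence module over `𝕜`, indexed by `ℝ`. -/
structure PersistenceModule (𝕜 : Type u) [Field 𝕜] where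
  obj : ℝ → Type u
  [addCommGroup : ∀ a, AddCommGroup (obj a)]
  [module : ∀ a, Module 𝕜 (obj a)]
  map : ∀ {a b : ℝ}, a ≤ b → obj a →ₗ[𝕜] obj b
  map_refl : ∀ a, map (le_refl a) = LinearMap.id
  map_trans : ∀ {a b c : ℝ} (hab : a ≤ b) (hbc : b ≤ c),
    map hbc ∘ₗ map hab = map (hab.trans hbc)

attribute [instance] PersistenceModule.addCommGroup PersistenceModule.module

/-- A barcode: an indexed family of nonempty intervals (of any type) of the real line. -/
structure Barcode where
  index : Type
  bar : index → Set ℝ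
  nonempty : ∀ i, (bar i).Nonempty
  ordConnected : ∀ i, (bar i).OrdConnected

open scoped Classical in
/-- `B` is a barcode of `M`: `M` is isomorphic to the direct sum of the interval modules of the
bars of `B`. At `a` that direct sum is the space with basis the bars that contain `a`,
and its map from `a` to `b` fixes the basis elements that contain `b` and kills the others. -/
def PersistenceModule.HasBarcode {𝕜 : Type u} [Field 𝕜] (M : PersistenceModule 𝕜)
    (B : Barcode) : Prop :=
  ∃ φ : ∀ a, M.obj a ≃ₗ[𝕜] Finsupp.supported 𝕜 𝕜 {i | a ∈ B.bar i},
    ∀ (a b : ℝ) (hab : a ≤ b) (x : M.obj a),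
      φ b (M.map hab x) = Finsupp.restrictDom 𝕜 𝕜 {i | b ∈ B.bar i} (φ a x)

/-- The birth time of a bar. -/
def Barcode.birth (B : Barcode) (i : B.index) : EReal :=
  sInf ((fun t : ℝ => (t : EReal)) '' B.bar i)

/-- The death time of a bar. -/
def Barcode.death (B : Barcode) (i : B.index) : EReal :=
  sSup ((fun t : ℝ => (t : EReal)) '' B.bar i)

/-- The point of the persistence diagram given by a bar. -/
def Barcode.point (B : Barcode) (i : B.index) : EReal × EReal := (B.birth i, B.death i)

/-- The `ℓ^p` norm of a family of extended nonnegative numbers (`1 ≤ p ≤ ∞`). -/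
def ellNorm (p : ℝ≥0∞) {ι : Type*} (u : ι → ℝ≥0∞) : ℝ≥0∞ :=
  if p = ∞ then ⨆ i, u i else (∑' i, u i ^ p.toReal) ^ (1 / p.toReal)

/-- `|x - y|` on the extended reals, with `|∞ - ∞| = 0`. -/
def coordDist (x y : EReal) : ℝ≥0∞ := if x = y then 0 else (x - y).abs

/-- The `ℓ^p` distance in the extended plane. -/
def pointDist (p : ℝ≥0∞) (x y : EReal × EReal) : ℝ≥0∞ :=
  ellNorm p ![coordDist x.1 y.1, coordDist x.2 y.2]

/-- The `ℓ^p` distance to the diagonal. -/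
def diagDist (p : ℝ≥0∞) (x : EReal × EReal) : ℝ≥0∞ :=
  ⨅ t : ℝ, pointDist p x ((t : EReal), (t : EReal))

/-- The cost of a matching of two diagrams. A matching is a partial bijection; the points that
it leaves out, on either side, are matched to the diagonal. -/
def matchingCost (p : ℝ≥0∞) (B C : Barcode) (m : B.index ≃. C.index) : ℝ≥0∞ :=
  ellNorm p (Sum.elim
    (fun i : B.index => (m i).elim (diagDist p (B.point i)) fun j =>
      pointDist p (B.point i) (C.point j))
    (fun j : C.index => (m.symm j).elim (diagDist p (C.point j)) fun _ => 0))

/-- The `p`-Wasserstein distance (with `ℓ^p` ground distance) of two persistence diagrams. -/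
def wasserstein (p : ℝ≥0∞) (B C : Barcode) : ℝ≥0∞ :=
  ⨅ m : B.index ≃. C.index, matchingCost p B C m

/-- The total `p`-Wasserstein distance of two graded persistence diagrams. -/
def totalWasserstein (p : ℝ≥0∞) (D E : ℕ → Barcode) : ℝ≥0∞ :=
  ellNorm p fun k => wasserstein p (D k) (E k)

/-! ### Cubical complexes, monotone functions, persistent homology -/

/-- A finite cubical complex in the grid. -/
structure CubicalComplex (d : ℕ) where
  cells : Set (ElemCube d)
  finite : cells.Finite
  face_mem : ∀ {τ σ : ElemCube d}, τ.IsFace σ → σ ∈ cells → τ ∈ cells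

namespace CubicalComplex

variable {d : ℕ}

/-- A real function on the cells of `K` whose value at a face is at most the value at the cell. -/
structure MonotoneFunction (K : CubicalComplex d) where
  toFun : K.cells → ℝ
  monotone : ∀ τ σ : K.cells, τ.1.IsFace σ.1 → toFun τ ≤ toFun σ

namespace MonotoneFunction

variable {K : CubicalComplex d}

/-- The sublevel complex `{σ ∈ K | h σ ≤ a}`. -/
def sublevel (h : K.MonotoneFunction) (a : ℝ) : Set (ElemCube d) :=
  {σ | ∃ hσ : σ ∈ K.cells, h.toFun ⟨σ, hσ⟩ ≤ a}

theorem sublevel_mono (h : K.MonotoneFunction) {a b : ℝ} (hab : a ≤ b) :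
    h.sublevel a ⊆ h.sublevel b :=
  fun _ ⟨hσ, hle⟩ => ⟨hσ, hle.trans hab⟩

/-- The degree `k` homology of the sublevel set filtration of `h`. -/
def persistentHomology (𝕜 : Type u) [Field 𝕜] (h : K.MonotoneFunction) (k : ℕ) :
    PersistenceModule 𝕜 where
  obj a := ElemCube.Homology 𝕜 (h.sublevel a) k
  map hab := ElemCube.homologyMap 𝕜 (h.sublevel_mono hab) k
  map_refl a := by
    refine Submodule.linearMap_qext _ ?_
    rfl
  map_trans hab hbc := by
    refine Submodule.linearMap_qext _ ?_
    rfl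

/-- `D` is the persistence diagram of `h`: for each `k`, the barcode `D k` is a barcode of the
degree `k` persistent homology of `h`. -/
def HasDiagram (𝕜 : Type*) [Field 𝕜] (h : K.MonotoneFunction) (D : ℕ → Barcode) : Prop :=
  ∀ k, (h.persistentHomology 𝕜 k).HasBarcode (D k)

end MonotoneFunction

end CubicalComplex

/-! ### The two cubical complexes of a grayscale image -/

namespace GrayscaleImage

variable {d : ℕ}

/-- Method 1: the voxels `v ∈ S` are the `d`-dimensional cells; the complex consists of them and
all of their faces. -/
def topComplex (S : Finset (Fin d → ℤ)) : CubicalComplex d where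
  cells := {σ | ∃ v ∈ S, σ.IsFace (ElemCube.voxel v)}
  finite := by
    have key : Set.Finite (⋃ v ∈ S,
        (fun q : (Fin d → ℤ) × Finset (Fin d) => (⟨q.1, q.2⟩ : ElemCube d)) ''
          (Set.Icc v (v + 1) ×ˢ Set.univ)) :=
      S.finite_toSet.biUnion fun v _ => ((Set.finite_Icc v (v + 1)).prod Set.finite_univ).image _
    refine key.subset ?_
    rintro σ ⟨v, hv, hσ⟩
    simp only [Set.mem_iUnion]
    refine ⟨v, hv, (σ.base, σ.dirs), ⟨⟨fun i => ?_, fun i => ?_⟩, trivial⟩, rfl⟩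
    all_goals
      have h := hσ.2 i
      simp only [ElemCube.voxel, Pi.add_apply, Pi.one_apply] at h ⊢
      omega
  face_mem := by
    rintro τ σ h ⟨v, hv, hσ⟩
    exact ⟨v, hv, h.trans hσ⟩

open scoped Classical in
/-- Method 1: the value at a cell is the minimum of the values of the voxels that contain it. -/
def topFunction {S : Finset (Fin d → ℤ)} (f : S → ℝ) : (topComplex S).MonotoneFunction where
  toFun σ := (Finset.univ.filter fun v : S => σ.1.IsFace (ElemCube.voxel v.1)).inf' (by
    obtain ⟨v, hv, h⟩ := σ.2
    exact ⟨⟨v, hv⟩, by simpa using h⟩) f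
  monotone τ σ h := by
    refine Finset.inf'_mono f (fun v hv => ?_) _
    simp only [Finset.mem_filter, Finset.mem_univ, true_and] at hv ⊢
    exact h.trans hv

/-- Method 2: the voxels `v ∈ S` are the vertices; the complex consists of all the cubes with
all of their vertices in `S`. -/
def dualComplex (S : Finset (Fin d → ℤ)) : CubicalComplex d where
  cells := {σ | ∀ v, (ElemCube.vertex v).IsFace σ → v ∈ S}
  finite := by
    have key : Set.Finite
        ((fun q : (Fin d → ℤ) × Finset (Fin d) => (⟨q.1, q.2⟩ : ElemCube d)) ''
          ((S : Set (Fin d → ℤ)) ×ˢ Set.univ)) :=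
      (S.finite_toSet.prod Set.finite_univ).image _
    refine key.subset fun σ hσ => ⟨(σ.base, σ.dirs), ⟨hσ _ ?_, trivial⟩, rfl⟩
    exact ⟨by simp [ElemCube.vertex], fun i => Or.inl rfl⟩
  face_mem := fun h hσ v hv => hσ v (hv.trans h)

open scoped Classical in
/-- Method 2: the value at a cell is the maximum of the values of the voxels that are its
vertices. -/
def dualFunction {S : Finset (Fin d → ℤ)} (f : S → ℝ) : (dualComplex S).MonotoneFunction where
  toFun σ := (Finset.univ.filter fun v : S => (ElemCube.vertex v.1).IsFace σ.1).sup' (by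
    have h : (ElemCube.vertex σ.1.base).IsFace σ.1 := ⟨by simp [ElemCube.vertex], fun i => Or.inl rfl⟩
    exact ⟨⟨σ.1.base, σ.2 _ h⟩, by simpa using h⟩) f
  monotone τ σ h := by
    refine Finset.sup'_mono f (fun v hv => ?_) _
    simp only [Finset.mem_filter, Finset.mem_univ, true_and] at hv ⊢
    exact hv.trans h

/-- The two methods for making a filtered cubical complex of an image. -/
inductive Method
  | topCells
  | dual

/-- The cubical complex made by a method from an image with voxel set `S`. -/
def Method.complex (m : Method) (S : Finset (Fin d → ℤ)) : CubicalComplex d :=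
  match m with
  | .topCells => topComplex S
  | .dual => dualComplex S

/-- The monotone function made by a method from an image `f`. -/
def Method.function (m : Method) {S : Finset (Fin d → ℤ)} (f : S → ℝ) :
    (m.complex S).MonotoneFunction :=
  match m with
  | .topCells => topFunction f
  | .dual => dualFunction f

end GrayscaleImage

end

noncomputable section

/-! ### The cellular boundary squares to zero -/

namespace ElemCube

variable {d : ℕ} (𝕜 : Type*) [Field 𝕜]

/-! The heart is cellular stability (`close_of_hasDiagram`): for monotone functions on one finite
complex, the total Wasserstein distance of the diagrams is at most the `ℓ^p` norm, over the cells,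
of the difference of the functions.

For a linear order of the cells that refines the face relation, column reduction gives a basis of
the chains in which the boundary is a partial matching `σ ↦ low σ` (`exists_normalForm`). If a
monotone function is weakly increasing for that order, its diagram can be read off the matching: an
unkilled cycle `τ` gives `(h τ, ∞)`, a pair `low σ = τ` gives `(h τ, h σ)`. Two functions weakly
increasing for the same order share the matching, and pairing the points with the same `τ` uses each
cell in at most one coordinate, so the cost is at most the norm of the difference
(`NormalForm.close`).

In general, join the two functions by a straight line. Near a parameter `t` every strict inequality
valid at `t` persists, so a nearby function and the one at `t` share an order
(`exists_lineMap_order`, `exists_compatible_normalForm`). The local estimates are proportional to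
the length of the parameter interval and add up by the triangle inequality for couplings
(`Close.trans`, `Icc_induction_of_local`). Since the diagrams in the statement are arbitrary
interval decompositions, uniqueness of barcodes (`barcode_unique`) is needed to compare them with
those of a normal form.

For images, the change at a cell is bounded by the change at some incident voxel, and a voxel is
incident to at most `3 ^ d` cells. The constant in the statement is `3 ^ d` by the binomial theorem.
-/

theorem boundary_single (σ : ElemCube d) :
    boundary 𝕜 d (Finsupp.single σ 1) = ∑ i ∈ σ.dirs,
      σ.sign 𝕜 i • (Finsupp.single (σ.upper i) 1 - Finsupp.single (σ.lower i) 1) := by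
  simp [boundary]

theorem sign_congr {σ τ : ElemCube d} (h : σ.dirs = τ.dirs) (i : Fin d) :
    σ.sign 𝕜 i = τ.sign 𝕜 i := by
  simp [sign, h]

theorem sign_lower_of_lt (σ : ElemCube d) {i j : Fin d} (hi : i ∈ σ.dirs) (h : i < j) :
    (σ.lower i).sign 𝕜 j = -σ.sign 𝕜 j := by
  have : σ.dirs.filter (· < j) = insert i ((σ.dirs.erase i).filter (· < j)) := by
    ext x
    simp only [Finset.mem_filter, Finset.mem_insert, Finset.mem_erase]
    grind
  simp only [sign, lower]
  rw [this, Finset.card_insert_of_notMem (by simp), pow_succ]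
  simp

theorem sign_lower_of_gt (σ : ElemCube d) {i j : Fin d} (h : j < i) :
    (σ.lower i).sign 𝕜 j = σ.sign 𝕜 j := by
  have : σ.dirs.filter (· < j) = (σ.dirs.erase i).filter (· < j) := by
    ext x
    simp only [Finset.mem_filter, Finset.mem_erase]
    grind
  simp only [sign, lower]
  rw [this]

theorem sign_mul_sign_lower (σ : ElemCube d) {i j : Fin d} (hi : i ∈ σ.dirs) (hj : j ∈ σ.dirs)
    (hij : i ≠ j) :
    σ.sign 𝕜 i * (σ.lower i).sign 𝕜 j = -(σ.sign 𝕜 j * (σ.lower j).sign 𝕜 i) := by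
  rcases lt_or_gt_of_ne hij with h | h
  · rw [sign_lower_of_lt 𝕜 σ hi h, sign_lower_of_gt 𝕜 σ h]; ring
  · rw [sign_lower_of_lt 𝕜 σ hj h, sign_lower_of_gt 𝕜 σ h]; ring

theorem boundary_boundary (x : ElemCube d →₀ 𝕜) : boundary 𝕜 d (boundary 𝕜 d x) = 0 := by
  suffices h : boundary 𝕜 d ∘ₗ boundary 𝕜 d = 0 from LinearMap.congr_fun h x
  refine Finsupp.lhom_ext' fun σ => LinearMap.ext_ring ?_
  simp only [LinearMap.coe_comp, Function.comp_apply, Finsupp.lsingle_apply, LinearMap.zero_apply]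
  rw [boundary_single, map_sum]
  let T : Fin d → Fin d → (ElemCube d →₀ 𝕜) := fun i j =>
    (σ.sign 𝕜 i * (σ.lower i).sign 𝕜 j) •
      ((Finsupp.single ((σ.upper i).upper j) 1 - Finsupp.single ((σ.upper i).lower j) 1) -
      (Finsupp.single ((σ.lower i).upper j) 1 - Finsupp.single ((σ.lower i).lower j) 1))
  have key : ∀ i ∈ σ.dirs, boundary 𝕜 d
      (σ.sign 𝕜 i • (Finsupp.single (σ.upper i) 1 - Finsupp.single (σ.lower i) 1)) =
      ∑ j ∈ σ.dirs.erase i, T i j := by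
    intro i _
    rw [map_smul, map_sub, boundary_single, boundary_single]
    change _ • (∑ j ∈ σ.dirs.erase i, _ - ∑ j ∈ σ.dirs.erase i, _) = _
    rw [← Finset.sum_sub_distrib, Finset.smul_sum]
    refine Finset.sum_congr rfl fun j _ => ?_
    rw [sign_congr 𝕜 (show (σ.upper i).dirs = (σ.lower i).dirs from rfl), ← smul_sub, smul_smul]
  rw [Finset.sum_congr rfl key, Finset.sum_sigma']
  -- Exchanging the two directions gives the same iterated facets with the opposite sign.
  refine Finset.sum_involution (fun q _ => ⟨q.2, q.1⟩) ?_ ?_ ?_ ?_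
  · rintro ⟨i, j⟩ h
    simp only [Finset.mem_sigma, Finset.mem_erase] at h
    obtain ⟨hi, hji, hj⟩ := h
    have e₁ : (σ.upper i).upper j = (σ.upper j).upper i := by
      simp [upper, Finset.erase_right_comm, add_right_comm]
    have e₂ : (σ.upper i).lower j = (σ.lower j).upper i := by
      simp [upper, lower, Finset.erase_right_comm]
    have e₃ : (σ.lower i).upper j = (σ.upper j).lower i := by
      simp [upper, lower, Finset.erase_right_comm]
    have e₄ : (σ.lower i).lower j = (σ.lower j).lower i := by
      simp [lower, Finset.erase_right_comm]
    simp only [T]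
    rw [sign_mul_sign_lower 𝕜 σ hi hj hji.symm, e₁, e₂, e₃, e₄]
    module
  · rintro ⟨i, j⟩ h _ h'
    simp only [Finset.mem_sigma, Finset.mem_erase] at h
    simp only [Sigma.mk.injEq] at h'
    exact h.2.1 h'.1
  · rintro ⟨i, j⟩ h
    simp only [Finset.mem_sigma, Finset.mem_erase] at h ⊢
    exact ⟨h.2.2, h.2.1.symm, h.1⟩
  · rintro ⟨i, j⟩ h
    rfl

theorem lower_isFace (σ : ElemCube d) (i : Fin d) : (σ.lower i).IsFace σ :=
  ⟨Finset.erase_subset _ _, fun _ => Or.inl rfl⟩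

theorem upper_isFace (σ : ElemCube d) {i : Fin d} (hi : i ∈ σ.dirs) : (σ.upper i).IsFace σ := by
  refine ⟨Finset.erase_subset _ _, fun j => ?_⟩
  by_cases h : j = i
  · subst h
    right
    simp [upper, hi]
  · left
    simp [upper, h]

theorem dim_lower_add_one (σ : ElemCube d) {i : Fin d} (hi : i ∈ σ.dirs) :
    (σ.lower i).dim + 1 = σ.dim :=
  Finset.card_erase_add_one hi

theorem dim_upper_add_one (σ : ElemCube d) {i : Fin d} (hi : i ∈ σ.dirs) :
    (σ.upper i).dim + 1 = σ.dim :=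
  Finset.card_erase_add_one hi

theorem boundary_single_mem (σ : ElemCube d) :
    boundary 𝕜 d (Finsupp.single σ 1) ∈
      Finsupp.supported 𝕜 𝕜 {τ : ElemCube d | τ.IsFace σ ∧ τ.dim + 1 = σ.dim} := by
  rw [boundary_single]
  refine Submodule.sum_mem _ fun i hi => Submodule.smul_mem _ _ (Submodule.sub_mem _ ?_ ?_)
  · exact Finsupp.single_mem_supported _ _ ⟨upper_isFace σ hi, dim_upper_add_one σ hi⟩
  · exact Finsupp.single_mem_supported _ _ ⟨lower_isFace σ i, dim_lower_add_one σ hi⟩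

end ElemCube

/-! ### Normal form of a filtered complex -/

section NormalForm

variable {α 𝕜 : Type*} [Field 𝕜]

/-- One inclusion is given, and both sides have dimension `|Y|`. -/
theorem span_image_eq_supported (e : α → α →₀ 𝕜) (he : LinearIndependent 𝕜 e) {Y : Set α}
    (hY : Y.Finite) (h : ∀ σ ∈ Y, e σ ∈ Finsupp.supported 𝕜 𝕜 Y) :
    Submodule.span 𝕜 (e '' Y) = Finsupp.supported 𝕜 𝕜 Y := by
  have := hY.fintype
  have : FiniteDimensional 𝕜 (Finsupp.supported 𝕜 𝕜 Y) :=
    Module.Finite.equiv (Finsupp.supportedEquivFinsupp (M := 𝕜) (R := 𝕜) Y).symm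
  refine Submodule.eq_of_le_of_finrank_eq ?_ ?_
  · rw [Submodule.span_le]
    rintro _ ⟨σ, hσ, rfl⟩
    exact h σ hσ
  · rw [(Finsupp.supportedEquivFinsupp (M := 𝕜) (R := 𝕜) Y).finrank_eq, Module.finrank_finsupp_self,
      show e '' Y = Set.range fun σ : Y => e σ by rw [Set.image_eq_range]]
    exact finrank_span_eq_card (he.comp _ Subtype.val_injective)

theorem map_mem_supported (D : (α →₀ 𝕜) →ₗ[𝕜] (α →₀ 𝕜)) {X Y : Set α}
    (h : ∀ σ ∈ X, D (Finsupp.single σ 1) ∈ Finsupp.supported 𝕜 𝕜 Y) {x : α →₀ 𝕜}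
    (hx : x ∈ Finsupp.supported 𝕜 𝕜 X) : D x ∈ Finsupp.supported 𝕜 𝕜 Y := by
  rw [Finsupp.supported_eq_span_single] at hx
  refine (Submodule.span_le (p := (Finsupp.supported 𝕜 𝕜 Y).comap D)).2 ?_ hx
  rintro _ ⟨σ, hσ, rfl⟩
  exact h σ hσ

variable [LinearOrder α]

/-- In a vanishing combination, let `m` be the largest index used: only `e m` contributes to the
coordinate `m`, so its coefficient is zero. -/
theorem linearIndependent_of_triangular (e : α → α →₀ 𝕜) (h₀ : ∀ σ, e σ σ ≠ 0)
    (h : ∀ σ, e σ ∈ Finsupp.supported 𝕜 𝕜 (Set.Iic σ)) : LinearIndependent 𝕜 e := by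
  rw [linearIndependent_iff]
  intro l hl
  by_contra hne
  have hs : l.support.Nonempty := Finsupp.support_nonempty_iff.2 hne
  set m := l.support.max' hs
  have hm : m ∈ l.support := Finset.max'_mem _ _
  have : (Finsupp.linearCombination 𝕜 e l) m = l m * e m m := by
    rw [Finsupp.linearCombination_apply, Finsupp.sum, Finsupp.finsetSum_apply,
      Finset.sum_eq_single_of_mem m hm]
    · simp
    · intro b hb hbm
      have hlt : b < m := lt_of_le_of_ne (Finset.le_max' _ _ hb) hbm
      have : e b m = 0 := by
        by_contra hc
        exact absurd (h b (Finsupp.mem_support_iff.2 hc)) (not_le.2 hlt)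
      simp [this]
  rw [hl] at this
  exact mul_ne_zero (Finsupp.mem_support_iff.1 hm) (h₀ m) this.symm

/-- The elimination step of column reduction: the leading terms cancel and nothing larger appears.
-/
theorem support_max_sub_smul_lt {x y : α →₀ 𝕜} {τ : α} (hx : x.support.max = τ)
    (hy : y.support.max = τ) : (x - (x τ / y τ) • y).support.max < τ := by
  have hyτ : y τ ≠ 0 := Finsupp.mem_support_iff.1 (Finset.mem_of_max hy)
  rw [Finset.max, Finset.sup_lt_iff (WithBot.bot_lt_coe τ)]
  intro ρ hρ
  rw [WithBot.coe_lt_coe]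
  have hρ' : x ρ - x τ / y τ * y ρ ≠ 0 := by simpa using hρ
  have hne : ρ ≠ τ := by
    rintro rfl
    exact hρ' (by field_simp; simp)
  refine lt_of_le_of_ne ?_ hne
  by_cases h : x ρ = 0
  · have : y ρ ≠ 0 := fun h' => hρ' (by simp [h, h'])
    exact Finset.le_max_of_eq (Finsupp.mem_support_iff.2 this) hy
  · exact Finset.le_max_of_eq (Finsupp.mem_support_iff.2 h) hx

/-- A homogeneous basis adapted to a filtered complex, in which the differential sends each basis
element to zero or to another basis element, and no two of them to the same one. -/
theorem exists_normalForm (dim : α → ℕ) {s : Set α} (hs : s.Finite)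
    (D : (α →₀ 𝕜) →ₗ[𝕜] (α →₀ 𝕜)) (hDD : ∀ x, D (D x) = 0)
    (hD : ∀ σ ∈ s, D (Finsupp.single σ 1) ∈
      Finsupp.supported 𝕜 𝕜 {τ | τ ∈ s ∧ τ < σ ∧ dim τ + 1 = dim σ}) :
    ∃ (e : Module.Basis α 𝕜 (α →₀ 𝕜)) (low : α → Option α),
      (∀ σ ∈ s, e σ ∈ Finsupp.supported 𝕜 𝕜 {τ | τ ∈ s ∧ τ ≤ σ ∧ dim τ = dim σ}) ∧
      (∀ σ ∈ s, low σ = none → D (e σ) = 0) ∧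
      (∀ σ ∈ s, ∀ τ, low σ = some τ →
        τ ∈ s ∧ τ < σ ∧ dim τ + 1 = dim σ ∧ D (e σ) = e τ) ∧
      (∀ σ ∈ s, ∀ σ' ∈ s, ∀ τ, low σ = some τ → low σ' = some τ → σ = σ') := by
  classical
  let A : α → Submodule 𝕜 (α →₀ 𝕜) := fun σ =>
    Finsupp.supported 𝕜 𝕜 {τ | τ ∈ s ∧ τ < σ ∧ dim τ = dim σ}
  let A' : α → Submodule 𝕜 (α →₀ 𝕜) := fun σ =>
    Finsupp.supported 𝕜 𝕜 {τ | τ ∈ s ∧ τ ≤ σ ∧ dim τ = dim σ}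
  let C : α → Submodule 𝕜 (α →₀ 𝕜) := fun σ =>
    Finsupp.supported 𝕜 𝕜 {τ | τ ∈ s ∧ τ < σ ∧ dim τ + 1 = dim σ}
  have hAA' : ∀ σ, A σ ≤ A' σ := fun σ =>
    Finsupp.supported_mono fun τ h => ⟨h.1, h.2.1.le, h.2.2⟩
  have hA' : ∀ σ ∈ s, ∀ w, w - Finsupp.single σ 1 ∈ A σ → w ∈ A' σ := by
    intro σ hσ w hw
    have := Submodule.add_mem _ (hAA' σ hw)
      (Finsupp.single_mem_supported 𝕜 (1 : 𝕜)
        (⟨hσ, le_rfl, rfl⟩ : σ ∈ {τ | τ ∈ s ∧ τ ≤ σ ∧ dim τ = dim σ}))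
    simpa using this
  have hDA' : ∀ σ, ∀ x ∈ A' σ, D x ∈ C σ := by
    intro σ x hx
    refine map_mem_supported D (fun τ hτ => ?_) hx
    refine Finsupp.supported_mono ?_ (hD τ hτ.1)
    rintro ρ ⟨h₁, h₂, h₃⟩
    exact ⟨h₁, h₂.trans_le hτ.2.1, h₃.trans hτ.2.2⟩
  -- Instead of running the reduction, take `w σ` to be a chain with leading term `σ` whose boundary
  -- has the smallest possible leading cell (`⊥` for a cycle).
  have hw : ∀ σ : α, ∃ w : α →₀ 𝕜, σ ∈ s → (w - Finsupp.single σ 1 ∈ A σ ∧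
      ∀ w', w' - Finsupp.single σ 1 ∈ A σ → (D w).support.max ≤ (D w').support.max) := by
    intro σ
    by_cases hσ : σ ∈ s
    swap
    · exact ⟨0, fun h => absurd h hσ⟩
    let R : Set (WithBot α) := (fun w => (D w).support.max) '' {w | w - Finsupp.single σ 1 ∈ A σ}
    have hR : R.Finite := by
      refine ((hs.image (WithBot.some)).insert ⊥).subset ?_
      rintro _ ⟨w, hw, rfl⟩
      dsimp only
      induction h : (D w).support.max with
      | bot => exact Set.mem_insert _ _
      | coe τ =>
        exact Set.mem_insert_of_mem _ ⟨τ, (hDA' σ w (hA' σ hσ w hw) (Finset.mem_of_max h)).1, rfl⟩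
    obtain ⟨_, ⟨w, hw, rfl⟩, hmin⟩ := Set.exists_min_image R id hR
      ⟨_, Finsupp.single σ 1, by simp, rfl⟩
    exact ⟨w, fun _ => ⟨hw, fun w' hw' => hmin _ ⟨w', hw', rfl⟩⟩⟩
  choose w hw using hw
  have hwA : ∀ σ ∈ s, w σ ∈ A' σ := fun σ hσ => hA' σ hσ _ (hw σ hσ).1
  have hDw : ∀ σ ∈ s, D (w σ) ∈ C σ := fun σ hσ => hDA' σ _ (hwA σ hσ)
  have hlead : ∀ σ ∈ s, ∀ τ : α, (D (w σ)).support.max = τ →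
      τ ∈ s ∧ τ < σ ∧ dim τ + 1 = dim σ := fun σ hσ τ h => hDw σ hσ (Finset.mem_of_max h)
  have hinj : ∀ σ ∈ s, ∀ σ' ∈ s, ∀ τ : α, (D (w σ)).support.max = τ →
      (D (w σ')).support.max = τ → ¬ σ < σ' := by
    intro σ hσ σ' hσ' τ h h' hlt
    have hd := (hlead σ hσ τ h).2.2.symm.trans (hlead σ' hσ' τ h').2.2
    have hmem : w σ ∈ A σ' := by
      refine Finsupp.supported_mono ?_ (hwA σ hσ)
      rintro ρ ⟨h₁, h₂, h₃⟩
      exact ⟨h₁, h₂.trans_lt hlt, h₃.trans hd⟩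
    -- If `σ < σ'` had the same leading cell, subtracting a multiple of `w σ` would improve on `w
    -- σ'`.
    have h₁ := (hw σ' hσ').2 (w σ' - (D (w σ') τ / D (w σ) τ) • w σ) (by
      rw [sub_right_comm]
      exact Submodule.sub_mem _ (hw σ' hσ').1 (Submodule.smul_mem _ _ hmem))
    rw [map_sub, map_smul, h'] at h₁
    exact absurd h₁ (not_le.2 (support_max_sub_smul_lt h' h))
  have hinj' : ∀ σ ∈ s, ∀ σ' ∈ s, ∀ τ : α, (D (w σ)).support.max = τ →
      (D (w σ')).support.max = τ → σ = σ' := fun σ hσ σ' hσ' τ h h' =>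
    le_antisymm (not_lt.1 (hinj σ' hσ' σ hσ τ h' h)) (not_lt.1 (hinj σ hσ σ' hσ' τ h h'))
  have hcyc : ∀ σ ∈ s, ∀ τ : α, (D (w σ)).support.max = τ → D (w τ) = 0 := by
    intro σ hσ τ h
    have hτ := hlead σ hσ τ h
    have hc : D (w σ) τ ≠ 0 := Finsupp.mem_support_iff.1 (Finset.mem_of_max h)
    -- The normalized boundary of `w σ` is a competitor for `w τ` and is a cycle, so by minimality
    -- `w τ` is a cycle too.
    have := (hw τ hτ.1).2 ((D (w σ) τ)⁻¹ • D (w σ)) (by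
      intro ρ hρ
      have hρ' : (D (w σ) τ)⁻¹ * D (w σ) ρ - Finsupp.single τ 1 ρ ≠ 0 := by
        simpa using hρ
      have hne : ρ ≠ τ := by
        rintro rfl
        exact hρ' (by simp [hc])
      have h0 : ρ ∈ (D (w σ)).support := by
        rw [Finsupp.mem_support_iff]
        intro h0
        exact hρ' (by simp [h0, hne.symm])
      have hρC := hDw σ hσ h0
      exact ⟨hρC.1, lt_of_le_of_ne (Finset.le_max_of_eq h0 h) hne,
        by have := hρC.2.2; have := hτ.2.2; omega⟩)
    rw [map_smul, hDD, smul_zero, Finsupp.support_zero, Finset.max_empty, le_bot_iff,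
      Finset.max_eq_bot, Finsupp.support_eq_empty] at this
    exact this
  let P : α → α → Prop := fun σ τ => σ ∈ s ∧ (D (w σ)).support.max = τ
  -- At a leading cell the chain `w σ` is replaced by the boundary it leads, which makes `D` send
  -- basis elements exactly to basis elements or zero.
  let e : α → α →₀ 𝕜 := fun σ =>
    if h : ∃ ρ, P ρ σ then D (w h.choose) else if σ ∈ s then w σ else Finsupp.single σ 1
  have e_low : ∀ {σ τ}, P σ τ → e τ = D (w σ) := by
    intro σ τ h
    have hex : ∃ ρ, P ρ τ := ⟨σ, h⟩
    simp only [e, dif_pos hex]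
    rw [hinj' _ hex.choose_spec.1 _ h.1 τ hex.choose_spec.2 h.2]
  have e_not : ∀ {σ}, σ ∈ s → (¬ ∃ ρ, P ρ σ) → e σ = w σ := fun hσ h => by
    simp only [e, dif_neg h, if_pos hσ]
  have e_out : ∀ {σ}, σ ∉ s → e σ = Finsupp.single σ 1 := fun {σ} hσ => by
    have : ¬ ∃ ρ, P ρ σ := fun ⟨ρ, h₁, h₂⟩ => hσ (hlead ρ h₁ σ h₂).1
    simp only [e, dif_neg this, if_neg hσ]
  have e_supp : ∀ σ ∈ s, e σ ∈ A' σ := by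
    intro σ hσ
    by_cases h : ∃ ρ, P ρ σ
    · obtain ⟨ρ, h⟩ := h
      rw [e_low h]
      intro τ hτ
      have h₁ := hDw ρ h.1 hτ
      have h₂ := hlead ρ h.1 σ h.2
      exact ⟨h₁.1, Finset.le_max_of_eq hτ h.2, by have := h₁.2.2; have := h₂.2.2; omega⟩
    · rw [e_not hσ h]
      exact hwA σ hσ
  have e_diag : ∀ σ, e σ σ ≠ 0 := by
    intro σ
    by_cases hσ : σ ∈ s
    swap
    · simp [e_out hσ]
    by_cases h : ∃ ρ, P ρ σ
    · obtain ⟨ρ, h⟩ := h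
      rw [e_low h]
      exact Finsupp.mem_support_iff.1 (Finset.mem_of_max h.2)
    · rw [e_not hσ h]
      have h₁ : (w σ - Finsupp.single σ (1 : 𝕜) : α →₀ 𝕜) σ = 0 := by
        by_contra hc
        exact lt_irrefl _ ((hw σ hσ).1 (Finsupp.mem_support_iff.2 hc)).2.1
      have h₂ : w σ σ = 1 := by simpa [sub_eq_zero] using h₁
      simp [h₂]
  have hli : LinearIndependent 𝕜 e := by
    refine linearIndependent_of_triangular e e_diag fun σ => ?_
    by_cases hσ : σ ∈ s
    · exact Finsupp.supported_mono (fun τ h => h.2.1) (e_supp σ hσ)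
    · rw [e_out hσ]
      exact Finsupp.single_mem_supported _ _ (Set.mem_Iic.2 le_rfl)
  have hspan : ⊤ ≤ Submodule.span 𝕜 (Set.range e) := by
    have h₁ := span_image_eq_supported e hli hs fun σ hσ =>
      Finsupp.supported_mono (fun τ h => h.1) (e_supp σ hσ)
    rw [← Finsupp.supported_univ, Finsupp.supported_eq_span_single, Submodule.span_le]
    rintro _ ⟨σ, -, rfl⟩
    by_cases hσ : σ ∈ s
    · refine Submodule.span_mono (Set.image_subset_range e s) ?_
      rw [h₁]
      exact Finsupp.single_mem_supported _ _ hσ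
    · rw [SetLike.mem_coe]
      dsimp only
      rw [← e_out hσ]
      exact Submodule.subset_span ⟨σ, rfl⟩
  let low : α → Option α := fun σ => if h : ∃ τ, P σ τ then some h.choose else none
  have low_some : ∀ {σ τ}, low σ = some τ ↔ P σ τ := by
    intro σ τ
    constructor
    · intro h
      by_cases hex : ∃ τ, P σ τ
      · simp only [low, dif_pos hex, Option.some.injEq] at h
        exact h ▸ hex.choose_spec
      · simp [low, dif_neg hex] at h
    · intro h
      have hex : ∃ τ, P σ τ := ⟨τ, h⟩
      simp only [low, dif_pos hex, Option.some.injEq]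
      exact WithBot.coe_injective (hex.choose_spec.2.symm.trans h.2)
  have low_none : ∀ {σ}, σ ∈ s → (low σ = none ↔ D (w σ) = 0) := by
    intro σ hσ
    rw [Option.eq_none_iff_forall_ne_some]
    constructor
    · intro h
      rw [← Finsupp.support_eq_empty, ← Finset.max_eq_bot]
      induction h' : (D (w σ)).support.max with
      | bot => rfl
      | coe τ => exact absurd (low_some.2 ⟨hσ, h'⟩) (h τ)
    · intro h τ h'
      have := (low_some.1 h').2
      simp [h] at this
  refine ⟨Module.Basis.mk hli hspan, low, ?_, ?_, ?_, ?_⟩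
  · intro σ hσ
    rw [Module.Basis.mk_apply]
    exact e_supp σ hσ
  · intro σ hσ h
    rw [Module.Basis.mk_apply]
    by_cases hex : ∃ ρ, P ρ σ
    · obtain ⟨ρ, hρ⟩ := hex
      rw [e_low hρ, hDD]
    · rw [e_not hσ hex, (low_none hσ).1 h]
  · intro σ hσ τ h
    have hP := low_some.1 h
    have hτ := hlead σ hσ τ hP.2
    refine ⟨hτ.1, hτ.2.1, hτ.2.2, ?_⟩
    rw [Module.Basis.mk_apply, Module.Basis.mk_apply, e_low hP, e_not hσ]
    -- A leading cell has `D (w σ) = 0`, so it cannot have a `low` of its own.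
    rintro ⟨ρ, hρ⟩
    rw [(low_none hσ).2 (hcyc ρ hρ.1 σ hρ.2)] at h
    cases h
  · intro σ hσ σ' hσ' τ h h'
    exact hinj' σ hσ σ' hσ' τ (low_some.1 h).2 (low_some.1 h').2

end NormalForm

/-! ### The barcode of a monotone function compatible with a normal form -/

section

variable {d : ℕ}

open scoped Classical in
/-- A monotone function extended by zero to all the cubes of the grid. -/
def CubicalComplex.MonotoneFunction.val {K : CubicalComplex d} (h : K.MonotoneFunction)
    (σ : ElemCube d) : ℝ :=
  if hσ : σ ∈ K.cells then h.toFun ⟨σ, hσ⟩ else 0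

theorem CubicalComplex.MonotoneFunction.val_of_mem {K : CubicalComplex d}
    (h : K.MonotoneFunction) {σ : ElemCube d} (hσ : σ ∈ K.cells) :
    h.val σ = h.toFun ⟨σ, hσ⟩ :=
  dif_pos hσ

theorem CubicalComplex.MonotoneFunction.mem_sublevel {K : CubicalComplex d}
    (h : K.MonotoneFunction) {σ : ElemCube d} {a : ℝ} :
    σ ∈ h.sublevel a ↔ σ ∈ K.cells ∧ h.val σ ≤ a := by
  constructor
  · rintro ⟨hσ, hle⟩
    exact ⟨hσ, by rwa [h.val_of_mem hσ]⟩
  · rintro ⟨hσ, hle⟩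
    exact ⟨hσ, by rwa [h.val_of_mem hσ] at hle⟩

/-- A basis of the chains in which the boundary operator of `K` is a partial matching: `low σ` is
the basis element that the boundary of `σ` is equal to, if that boundary is not zero. -/
structure NormalForm (𝕜 : Type*) [Field 𝕜] (K : CubicalComplex d) where
  basis : Module.Basis (ElemCube d) 𝕜 (ElemCube d →₀ 𝕜)
  low : ElemCube d → Option (ElemCube d)
  basis_mem : ∀ σ ∈ K.cells, basis σ ∈
    Finsupp.supported 𝕜 𝕜 {τ | τ ∈ K.cells ∧ τ.dim = σ.dim}
  boundary_eq_zero : ∀ σ ∈ K.cells, low σ = none → ElemCube.boundary 𝕜 d (basis σ) = 0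
  dim_low : ∀ σ ∈ K.cells, ∀ τ, low σ = some τ → τ.dim + 1 = σ.dim
  boundary_eq : ∀ σ ∈ K.cells, ∀ τ, low σ = some τ →
    ElemCube.boundary 𝕜 d (basis σ) = basis τ
  low_inj : ∀ σ ∈ K.cells, ∀ σ' ∈ K.cells, ∀ τ, low σ = some τ → low σ' = some τ → σ = σ'

namespace NormalForm

variable {𝕜 : Type*} [Field 𝕜] {K : CubicalComplex d} (N : NormalForm 𝕜 K)

/-- The function `h` does not increase along the basis elements of the normal form. -/
structure Compatible (h : K.MonotoneFunction) : Prop where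
  basis_le : ∀ σ ∈ K.cells, ∀ τ, N.basis σ τ ≠ 0 → h.val τ ≤ h.val σ
  low_le : ∀ σ ∈ K.cells, ∀ τ, N.low σ = some τ → h.val τ ≤ h.val σ

/-- The lifetime of the class of the basis element of `τ`. -/
def lifetime (h : K.MonotoneFunction) (τ : ElemCube d) : Set ℝ :=
  {a | h.val τ ≤ a ∧ ∀ σ ∈ K.cells, N.low σ = some τ → a < h.val σ}

/-- The barcode in degree `k` given by a normal form. -/
def barcode (h : K.MonotoneFunction) (k : ℕ) : Barcode where
  index := {τ : ElemCube d // τ ∈ K.cells ∧ τ.dim = k ∧ N.low τ = none ∧ (N.lifetime h τ).Nonempty}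
  bar := fun τ => N.lifetime h τ.1
  nonempty := fun τ => τ.2.2.2.2
  ordConnected := fun _ => ⟨fun _ ha _ hb _ hc =>
    ⟨ha.1.trans hc.1, fun σ hσ hl => hc.2.trans_lt (hb.2 σ hσ hl)⟩⟩

variable {N} {h : K.MonotoneFunction} (hN : N.Compatible h) {a : ℝ} {k : ℕ}

theorem mem_span_basis (Y : Set (ElemCube d)) (z : ElemCube d →₀ 𝕜) :
    z ∈ Submodule.span 𝕜 (N.basis '' Y) ↔ N.basis.repr z ∈ Finsupp.supported 𝕜 𝕜 Y :=
  N.basis.mem_span_image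

include hN in
-- Compatibility puts the basis elements indexed by a sublevel complex inside its chains. Thus one
-- basis serves all sublevel complexes at once.
theorem chains_eq_span : ElemCube.chains 𝕜 (h.sublevel a) k =
    Submodule.span 𝕜 (N.basis '' {σ | σ ∈ h.sublevel a ∧ σ.dim = k}) := by
  refine (span_image_eq_supported _ N.basis.linearIndependent ?_ ?_).symm
  · exact K.finite.subset fun σ hσ => (h.mem_sublevel.1 hσ.1).1
  · rintro σ ⟨hσ, rfl⟩ τ hτ
    rw [h.mem_sublevel] at hσ
    have h₁ := N.basis_mem σ hσ.1 hτ
    exact ⟨h.mem_sublevel.2 ⟨h₁.1,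
      (hN.basis_le σ hσ.1 τ (Finsupp.mem_support_iff.1 hτ)).trans hσ.2⟩, h₁.2⟩

include hN in
theorem mem_chains {z : ElemCube d →₀ 𝕜} : z ∈ ElemCube.chains 𝕜 (h.sublevel a) k ↔
    N.basis.repr z ∈ Finsupp.supported 𝕜 𝕜 {σ | σ ∈ h.sublevel a ∧ σ.dim = k} := by
  rw [chains_eq_span hN, mem_span_basis]

/-- Since `low` is injective where defined, only the basis element of `σ` contributes to the
coordinate `τ` of a boundary. -/
theorem repr_boundary {z : ElemCube d →₀ 𝕜} (hz : N.basis.repr z ∈ Finsupp.supported 𝕜 𝕜 K.cells)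
    {σ τ : ElemCube d} (hσ : σ ∈ K.cells) (hl : N.low σ = some τ) :
    N.basis.repr (ElemCube.boundary 𝕜 d z) τ = N.basis.repr z σ := by
  rw [← mem_span_basis] at hz
  induction hz using Submodule.span_induction with
  | mem x hx =>
    obtain ⟨ρ, hρ, rfl⟩ := hx
    rw [Module.Basis.repr_self]
    rcases h' : N.low ρ with _ | τ'
    · have hne : ρ ≠ σ := by rintro rfl; rw [hl] at h'; cases h'
      simp [N.boundary_eq_zero ρ hρ h', hne]
    · rw [N.boundary_eq ρ hρ τ' h', Module.Basis.repr_self]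
      by_cases hne : ρ = σ
      · subst hne
        rw [hl] at h'
        cases h'
        simp
      · have : τ' ≠ τ := by
          rintro rfl
          exact hne (N.low_inj ρ hρ σ hσ _ h' hl)
        simp [hne, this]
  | zero => simp
  | add x y _ _ hx hy => simp [hx, hy]
  | smul c x _ hx => simp [hx]

include hN in
theorem mem_cycles {z : ElemCube d →₀ 𝕜} : z ∈ ElemCube.cycles 𝕜 (h.sublevel a) k ↔
    N.basis.repr z ∈
      Finsupp.supported 𝕜 𝕜 {σ | σ ∈ h.sublevel a ∧ σ.dim = k ∧ N.low σ = none} := by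
  rw [ElemCube.cycles, Submodule.mem_inf, mem_chains hN, LinearMap.mem_ker]
  constructor
  · rintro ⟨hz, hb⟩ σ hσ
    obtain ⟨h₁, h₂⟩ := hz hσ
    refine ⟨h₁, h₂, ?_⟩
    rcases hl : N.low σ with _ | τ
    · rfl
    · have := repr_boundary (Finsupp.supported_mono (fun _ h' => (h.mem_sublevel.1 h'.1).1) hz)
        (h.mem_sublevel.1 h₁).1 hl
      rw [hb, map_zero] at this
      exact absurd this.symm (Finsupp.mem_support_iff.1 hσ)
  · intro hz
    refine ⟨fun σ hσ => ⟨(hz hσ).1, (hz hσ).2.1⟩, ?_⟩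
    rw [← mem_span_basis] at hz
    rw [← LinearMap.mem_ker]
    refine (Submodule.span_le.2 ?_) hz
    rintro _ ⟨σ, hσ, rfl⟩
    exact N.boundary_eq_zero σ (h.mem_sublevel.1 hσ.1).1 hσ.2.2

include hN in
theorem mem_boundaries {z : ElemCube d →₀ 𝕜} : z ∈ ElemCube.boundaries 𝕜 (h.sublevel a) k ↔
    N.basis.repr z ∈
      Finsupp.supported 𝕜 𝕜 {τ | ∃ σ ∈ h.sublevel a, σ.dim = k + 1 ∧ N.low σ = some τ} := by
  rw [ElemCube.boundaries, chains_eq_span hN, Submodule.map_span, ← mem_span_basis]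
  suffices H : Submodule.span 𝕜 (ElemCube.boundary 𝕜 d ''
      (N.basis '' {σ | σ ∈ h.sublevel a ∧ σ.dim = k + 1})) = Submodule.span 𝕜 (N.basis ''
        {τ | ∃ σ ∈ h.sublevel a, σ.dim = k + 1 ∧ N.low σ = some τ}) by rw [H]
  refine le_antisymm (Submodule.span_le.2 ?_) (Submodule.span_mono ?_)
  · rintro _ ⟨_, ⟨σ, hσ, rfl⟩, rfl⟩
    have hK := (h.mem_sublevel.1 hσ.1).1
    rcases hl : N.low σ with _ | τ
    · rw [N.boundary_eq_zero σ hK hl]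
      exact Submodule.zero_mem _
    · rw [N.boundary_eq σ hK τ hl]
      exact Submodule.subset_span ⟨τ, ⟨σ, hσ.1, hσ.2, hl⟩, rfl⟩
  · rintro _ ⟨τ, ⟨σ, hσ, hd, hl⟩, rfl⟩
    exact ⟨_, ⟨σ, ⟨hσ, hd⟩, rfl⟩, N.boundary_eq σ (h.mem_sublevel.1 hσ).1 τ hl⟩

variable (N h a k) in
/-- The coordinates of a chain along the bars of degree `k` that are alive at `a`. -/
def barCoord : (ElemCube d →₀ 𝕜) →ₗ[𝕜]
    Finsupp.supported 𝕜 𝕜 {i : (N.barcode h k).index | a ∈ (N.barcode h k).bar i} :=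
  haveI := Classical.decPred (· ∈ {i : (N.barcode h k).index | a ∈ (N.barcode h k).bar i})
  Finsupp.restrictDom 𝕜 𝕜 _ ∘ₗ Finsupp.lcomapDomain (fun i : (N.barcode h k).index => i.1)
    Subtype.val_injective ∘ₗ N.basis.repr.toLinearMap

open scoped Classical in
theorem barCoord_apply (z : ElemCube d →₀ 𝕜) (i : (N.barcode h k).index) :
    (barCoord N h a k z : (N.barcode h k).index →₀ 𝕜) i =
      if a ∈ (N.barcode h k).bar i then N.basis.repr z i.1 else 0 := by
  simp [barCoord, Finsupp.restrictDom_apply, Finsupp.filter_apply, Finsupp.lcomapDomain]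

include hN in
-- A basis cycle `τ` present at `a` is either alive, hence seen by a bar, or killed by some `σ`
-- already present, hence a boundary.
theorem barCoord_eq_zero_iff {z : ElemCube d →₀ 𝕜}
    (hz : z ∈ ElemCube.cycles 𝕜 (h.sublevel a) k) :
    barCoord N h a k z = 0 ↔ z ∈ ElemCube.boundaries 𝕜 (h.sublevel a) k := by
  classical
  rw [mem_boundaries hN]
  rw [mem_cycles hN] at hz
  constructor
  · intro h0 τ hτ
    by_contra hc
    obtain ⟨h₁, h₂, h₃⟩ := hz hτ
    rw [h.mem_sublevel] at h₁
    have hmem : a ∈ N.lifetime h τ := by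
      refine ⟨h₁.2, fun σ hσ hl => ?_⟩
      by_contra hle
      exact hc ⟨σ, h.mem_sublevel.2 ⟨hσ, not_lt.1 hle⟩, by
        rw [← N.dim_low σ hσ τ hl, h₂], hl⟩
    let i : (N.barcode h k).index := ⟨τ, h₁.1, h₂, h₃, Set.nonempty_of_mem hmem⟩
    have hi : a ∈ (N.barcode h k).bar i := hmem
    have := barCoord_apply (a := a) z i
    rw [h0, if_pos hi] at this
    exact Finsupp.mem_support_iff.1 hτ this.symm
  · intro hb
    ext i
    rw [barCoord_apply]
    split_ifs with hi
    · by_contra hc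
      obtain ⟨σ, hσ, -, hl⟩ := hb (Finsupp.mem_support_iff.2 hc)
      rw [h.mem_sublevel] at hσ
      exact absurd (hi.2 σ hσ.1 hl) (not_lt.2 hσ.2)
    · rfl

include hN in
theorem barCoord_surjective (y : Finsupp.supported 𝕜 𝕜
    {i : (N.barcode h k).index | a ∈ (N.barcode h k).bar i}) :
    ∃ z ∈ ElemCube.cycles 𝕜 (h.sublevel a) k, barCoord N h a k z = y := by
  classical
  let z := N.basis.repr.symm (Finsupp.mapDomain (fun i : (N.barcode h k).index => i.1) y.1)
  have hr : ∀ i : (N.barcode h k).index, N.basis.repr z i.1 = y.1 i := fun i => by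
    simp only [z, LinearEquiv.apply_symm_apply]
    exact Finsupp.mapDomain_apply Subtype.val_injective _ _
  refine ⟨z, ?_, ?_⟩
  · rw [mem_cycles hN]
    intro τ hτ
    simp only [z, LinearEquiv.apply_symm_apply] at hτ
    obtain ⟨i, hi, rfl⟩ := Finset.mem_image.1 (Finsupp.mapDomain_support hτ)
    exact ⟨h.mem_sublevel.2 ⟨i.2.1, (y.2 hi).1⟩, i.2.2.1, i.2.2.2.1⟩
  · ext i
    rw [barCoord_apply, hr]
    split_ifs with hi
    · rfl
    · by_contra hc
      exact hi (y.2 (Finsupp.mem_support_iff.2 (Ne.symm hc)))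

/-- The homology of a sublevel complex in terms of the bars that are alive. -/
def homologyEquiv (hN : N.Compatible h) : ElemCube.Homology 𝕜 (h.sublevel a) k ≃ₗ[𝕜]
    Finsupp.supported 𝕜 𝕜 {i : (N.barcode h k).index | a ∈ (N.barcode h k).bar i} :=
  let f := barCoord N h a k ∘ₗ (ElemCube.cycles 𝕜 (h.sublevel a) k).subtype
  (Submodule.quotEquivOfEq _ (LinearMap.ker f) (by
    ext z
    exact (barCoord_eq_zero_iff hN z.2).symm)).trans
  (f.quotKerEquivOfSurjective fun y => by
    obtain ⟨z, hz, hy⟩ := barCoord_surjective hN y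
    exact ⟨⟨z, hz⟩, hy⟩)

include hN in
-- The coordinates do not depend on `a`, so an inclusion only drops those whose bar has ended. A
-- nonzero coordinate of a cycle at `a` has already been born, so none is gained.
theorem hasBarcode (k : ℕ) : (h.persistentHomology 𝕜 k).HasBarcode (N.barcode h k) := by
  classical
  refine ⟨fun a => homologyEquiv hN, fun a b hab x => ?_⟩
  obtain ⟨z, rfl⟩ := Submodule.Quotient.mk_surjective _ x
  change barCoord N h b k z = Finsupp.restrictDom 𝕜 𝕜 _ (barCoord N h a k z).1
  ext i
  rw [barCoord_apply, Finsupp.restrictDom_apply, Finsupp.filter_apply, barCoord_apply]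
  by_cases hb : b ∈ (N.barcode h k).bar i
  · rw [if_pos hb, if_pos (show i ∈ {i | b ∈ (N.barcode h k).bar i} from hb)]
    split_ifs with ha
    · rfl
    · by_contra hc
      have := ((mem_cycles hN).1 z.2) (Finsupp.mem_support_iff.2 hc)
      exact ha ⟨(h.mem_sublevel.1 this.1).2, fun σ hσ hl => hab.trans_lt (hb.2 σ hσ hl)⟩
  · simp [hb]

end NormalForm

end

/-! ### Existence of normal forms -/

namespace CubicalComplex

variable {d : ℕ}

instance : Countable (ElemCube d) :=
  Function.Injective.countable (f := fun σ : ElemCube d => (σ.base, σ.dirs)) fun σ τ h => by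
    simp only [Prod.mk.injEq] at h
    exact ElemCube.ext h.1 h.2

/-- If the strict order relations of `h` are among those of `h'`, there is a normal form
compatible with both. -/
theorem exists_compatible_normalForm (𝕜 : Type*) [Field 𝕜] {K : CubicalComplex d}
    (h h' : K.MonotoneFunction)
    (hh : ∀ σ ∈ K.cells, ∀ τ ∈ K.cells, h.val σ < h.val τ → h'.val σ < h'.val τ) :
    ∃ N : NormalForm 𝕜 K, N.Compatible h ∧ N.Compatible h' := by
  obtain ⟨enc, henc⟩ := exists_injective_nat (ElemCube d)
  -- Sort by `h'`, which by `hh` also sorts `h` weakly. Ties are broken by dimension, to put facets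
  -- first, and then by an arbitrary enumeration.
  let key : ElemCube d → Lex (ℝ × Lex (ℕ × ℕ)) := fun σ =>
    toLex (h'.val σ, toLex (σ.dim, enc σ))
  have hkey : Function.Injective key := fun σ τ hστ => by
    simp only [key, toLex_inj, Prod.mk.injEq] at hστ
    exact henc hστ.2.2
  let O : LinearOrder (ElemCube d) := LinearOrder.lift' key hkey
  have lt_iff : ∀ {σ τ : ElemCube d}, σ < τ ↔ key σ < key τ := Iff.rfl
  have le_iff : ∀ {σ τ : ElemCube d}, σ ≤ τ ↔ key σ ≤ key τ := Iff.rfl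
  have le' : ∀ {σ τ : ElemCube d}, σ ≤ τ → h'.val σ ≤ h'.val τ := by
    intro σ τ hle
    rw [le_iff, Prod.Lex.toLex_le_toLex] at hle
    rcases hle with hle | hle
    · exact hle.le
    · exact hle.1.le
  have le : ∀ σ ∈ K.cells, ∀ τ ∈ K.cells, σ ≤ τ → h.val σ ≤ h.val τ := by
    intro σ hσ τ hτ hle
    by_contra hc
    exact absurd (le' hle) (not_le.2 (hh τ hτ σ hσ (not_le.1 hc)))
  have face_lt : ∀ σ ∈ K.cells, ∀ τ : ElemCube d, τ.IsFace σ → τ.dim + 1 = σ.dim →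
      τ ∈ K.cells ∧ τ < σ ∧ τ.dim + 1 = σ.dim := by
    intro σ hσ τ hf hd
    have hτ := K.face_mem hf hσ
    refine ⟨hτ, ?_, hd⟩
    have hle : h'.val τ ≤ h'.val σ := by
      rw [h'.val_of_mem hσ, h'.val_of_mem hτ]
      exact h'.monotone _ _ hf
    rw [lt_iff, Prod.Lex.toLex_lt_toLex]
    rcases hle.lt_or_eq with h₁ | h₁
    · exact Or.inl h₁
    · refine Or.inr ⟨h₁, ?_⟩
      rw [Prod.Lex.toLex_lt_toLex]
      exact Or.inl (by dsimp only; omega)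
  obtain ⟨e, low, h₁, h₂, h₃, h₄⟩ := exists_normalForm (𝕜 := 𝕜) ElemCube.dim K.finite
    (ElemCube.boundary 𝕜 d) (ElemCube.boundary_boundary 𝕜) fun σ hσ =>
      Finsupp.supported_mono (fun τ hτ => face_lt σ hσ τ hτ.1 hτ.2)
        (ElemCube.boundary_single_mem 𝕜 σ)
  refine ⟨⟨e, low, fun σ hσ τ hτ => ⟨(h₁ σ hσ hτ).1, (h₁ σ hσ hτ).2.2⟩, h₂,
    fun σ hσ τ hl => (h₃ σ hσ τ hl).2.2.1, fun σ hσ τ hl => (h₃ σ hσ τ hl).2.2.2, h₄⟩,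
    ⟨fun σ hσ τ hτ => ?_, fun σ hσ τ hl => ?_⟩, ⟨fun σ hσ τ hτ => ?_, fun σ hσ τ hl => ?_⟩⟩
  · have := h₁ σ hσ (Finsupp.mem_support_iff.2 hτ)
    exact le _ this.1 _ hσ this.2.1
  · have := h₃ σ hσ τ hl
    exact le _ this.1 _ hσ this.2.1.le
  · exact le' (h₁ σ hσ (Finsupp.mem_support_iff.2 hτ)).2.1
  · exact le' (h₃ σ hσ τ hl).2.1.le

end CubicalComplex

/-! ### Uniqueness of barcodes -/

section Uniqueness

/-- Möbius inversion on subsets of `V`: by induction from the largest `J` down, counts of supersets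
determine the multiplicity of each set. -/
theorem exists_equiv_of_card_superset_eq {ι κ : Type u} {β : Type*} [Fintype ι] [Fintype κ] [DecidableEq β]
    (V : Finset β) (S : ι → Finset β) (T : κ → Finset β) (hS : ∀ i, S i ⊆ V) (hT : ∀ j, T j ⊆ V)
    (hS₀ : ∀ i, (S i).Nonempty) (hT₀ : ∀ j, (T j).Nonempty)
    (h : ∀ J : Finset β, J.Nonempty → J ⊆ V →
      (Finset.univ.filter (J ⊆ S ·)).card = (Finset.univ.filter (J ⊆ T ·)).card) :
    ∃ e : ι ≃ κ, ∀ i, T (e i) = S i := by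
  have key : ∀ n, ∀ J : Finset β, V.card - J.card = n → J.Nonempty → J ⊆ V →
      (Finset.univ.filter (S · = J)).card = (Finset.univ.filter (T · = J)).card := by
    intro n
    induction n using Nat.strong_induction_on with
    | _ n ih =>
      intro J hn hJ hJV
      have count : ∀ {ι : Type u} [Fintype ι] (S : ι → Finset β), (∀ i, S i ⊆ V) →
          (Finset.univ.filter (J ⊆ S ·)).card = (Finset.univ.filter (S · = J)).card +
            ∑ J' ∈ V.powerset.filter (J ⊂ ·), (Finset.univ.filter (S · = J')).card := by
        intro ι _ S hS
        have h₁ := Finset.card_eq_sum_card_fiberwise (f := S)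
          (s := Finset.univ.filter (J ⊆ S ·)) (t := insert J (V.powerset.filter (J ⊂ ·)))
          (by
            intro i hi
            simp only [Finset.coe_filter, Finset.mem_univ, true_and] at hi
            simp only [Finset.coe_insert, Finset.coe_filter, Finset.mem_powerset]
            rcases eq_or_ne J (S i) with he | he
            · exact Or.inl he.symm
            · exact Or.inr ⟨hS i, lt_of_le_of_ne hi he⟩)
        rw [h₁, Finset.sum_insert (by simp)]
        congr 1
        · congr 1
          ext i
          simp only [Finset.mem_filter, Finset.mem_univ, true_and]
          exact ⟨fun h => h.2, fun h => ⟨h.ge, h⟩⟩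
        · refine Finset.sum_congr rfl fun J' hJ' => ?_
          simp only [Finset.mem_filter, Finset.mem_powerset] at hJ'
          congr 1
          ext i
          simp only [Finset.mem_filter, Finset.mem_univ, true_and]
          exact ⟨fun h => h.2, fun h => ⟨h ▸ hJ'.2.1, h⟩⟩
      have h₁ := h J hJ hJV
      rw [count S hS, count T hT] at h₁
      have h₂ : ∑ J' ∈ V.powerset.filter (J ⊂ ·), (Finset.univ.filter (S · = J')).card =
          ∑ J' ∈ V.powerset.filter (J ⊂ ·), (Finset.univ.filter (T · = J')).card := by
        refine Finset.sum_congr rfl fun J' hJ' => ?_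
        simp only [Finset.mem_filter, Finset.mem_powerset] at hJ'
        have c₁ := Finset.card_lt_card hJ'.2
        have c₂ := Finset.card_le_card hJ'.1
        exact ih (V.card - J'.card) (by omega) J' rfl (hJ.mono hJ'.2.1) hJ'.1
      omega
  have fib : ∀ J : Finset β, Nonempty ({i // S i = J} ≃ {j // T j = J}) := by
    intro J
    rw [← Fintype.card_eq, Fintype.card_subtype, Fintype.card_subtype]
    by_cases hJ : J.Nonempty ∧ J ⊆ V
    · exact key _ J rfl hJ.1 hJ.2
    · rw [Finset.filter_false_of_mem, Finset.filter_false_of_mem]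
      · rfl
      · rintro j - rfl
        exact hJ ⟨hT₀ j, hT j⟩
      · rintro i - rfl
        exact hJ ⟨hS₀ i, hS i⟩
  exact ⟨Equiv.ofFiberEquiv fun J => (fib J).some, fun i => Equiv.ofFiberEquiv_map _ _⟩

variable {𝕜 : Type u} [Field 𝕜] {M : PersistenceModule 𝕜} {B C : Barcode}

/-- The image of `M.map hab` has as basis the bars alive at both ends. Its dimension is intrinsic to
`M`, so these counts are the same for any two barcodes. -/
theorem PersistenceModule.HasBarcode.quotientEquiv (hB : M.HasBarcode B) {a b : ℝ} (hab : a ≤ b) :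
    Nonempty ((M.obj a ⧸ LinearMap.ker (M.map hab)) ≃ₗ[𝕜]
      Finsupp.supported 𝕜 𝕜 {i | a ∈ B.bar i ∧ b ∈ B.bar i}) := by
  classical
  obtain ⟨φ, hφ⟩ := hB
  let f : M.obj a →ₗ[𝕜] (B.index →₀ 𝕜) :=
    (Finsupp.supported 𝕜 𝕜 {i | b ∈ B.bar i}).subtype ∘ₗ (φ b).toLinearMap ∘ₗ M.map hab
  have hf : ∀ x, f x = (φ a x : B.index →₀ 𝕜).filter (· ∈ {i | b ∈ B.bar i}) := fun x => by
    simp only [f, LinearMap.comp_apply, LinearEquiv.coe_coe, hφ]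
    rw [Submodule.subtype_apply, Finsupp.restrictDom_apply]
  have hker : LinearMap.ker f = LinearMap.ker (M.map hab) := by
    ext x
    simp [f]
  have hrange : LinearMap.range f = Finsupp.supported 𝕜 𝕜 {i | a ∈ B.bar i ∧ b ∈ B.bar i} := by
    ext y
    constructor
    · rintro ⟨x, rfl⟩ i hi
      rw [hf, SetLike.mem_coe, Finsupp.mem_support_iff, Finsupp.filter_apply] at hi
      have hb : b ∈ B.bar i := by
        by_contra hc
        exact hi (if_neg hc)
      rw [if_pos (show i ∈ {i | b ∈ B.bar i} from hb)] at hi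
      exact ⟨(φ a x).2 (Finsupp.mem_support_iff.2 hi), hb⟩
    · intro hy
      have hya : y ∈ Finsupp.supported 𝕜 𝕜 {i | a ∈ B.bar i} :=
        Finsupp.supported_mono (fun i hi => hi.1) hy
      refine ⟨(φ a).symm ⟨y, hya⟩, ?_⟩
      rw [hf, LinearEquiv.apply_symm_apply, Finsupp.filter_eq_self_iff]
      exact fun i hi => (hy (Finsupp.mem_support_iff.2 hi)).2
  exact ⟨(Submodule.quotEquivOfEq _ _ hker.symm).trans
    (f.quotKerEquivRange.trans (LinearEquiv.ofEq _ _ hrange))⟩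

theorem PersistenceModule.HasBarcode.finite_alive (hB : M.HasBarcode B) (a : ℝ)
    [FiniteDimensional 𝕜 (M.obj a)] : Finite {i | a ∈ B.bar i} := by
  obtain ⟨φ, -⟩ := hB
  have := Module.Finite.equiv ((φ a).trans (Finsupp.supportedEquivFinsupp _))
  exact Module.Finite.finite_basis (Finsupp.basisSingleOne (R := 𝕜) (ι := {i | a ∈ B.bar i}))

theorem PersistenceModule.HasBarcode.card_alive_eq (hB : M.HasBarcode B) (hC : M.HasBarcode C)
    {a b : ℝ} (hab : a ≤ b) :
    Nat.card {i | a ∈ B.bar i ∧ b ∈ B.bar i} = Nat.card {j | a ∈ C.bar j ∧ b ∈ C.bar j} := by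
  obtain ⟨e⟩ := hB.quotientEquiv hab
  obtain ⟨e'⟩ := hC.quotientEquiv hab
  let E := (Finsupp.supportedEquivFinsupp _).symm.trans
    (e.symm.trans (e'.trans (Finsupp.supportedEquivFinsupp _)))
  exact Nat.card_congr ((Finsupp.basisSingleOne (R := 𝕜)).map E |>.indexEquiv
    (Finsupp.basisSingleOne (R := 𝕜)))

/-- A bar that ends between `a` and `b` gives a kernel vector; one that begins there gives a vector
outside the range. -/
theorem PersistenceModule.HasBarcode.mem_iff_of_bijective (hB : M.HasBarcode B) {a b : ℝ}
    (hab : a ≤ b) (h : Function.Bijective (M.map hab)) (i : B.index) :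
    a ∈ B.bar i ↔ b ∈ B.bar i := by
  classical
  obtain ⟨φ, hφ⟩ := hB
  constructor
  · intro ha
    by_contra hb
    let x := (φ a).symm ⟨Finsupp.single i 1, Finsupp.single_mem_supported _ _ ha⟩
    have hx : M.map hab x = 0 := by
      apply (φ b).injective
      rw [hφ, map_zero, LinearEquiv.apply_symm_apply]
      ext j
      rw [Finsupp.restrictDom_apply, Finsupp.filter_apply]
      split_ifs with hj
      · have : i ≠ j := by rintro rfl; exact hb hj
        simp [this]
      · rfl
    have h₀ : x = 0 := h.1 (hx.trans (map_zero _).symm)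
    have h₁ : (φ a x : B.index →₀ 𝕜) i = 1 := by simp [x]
    simp [h₀] at h₁
  · intro hb
    obtain ⟨x, hx⟩ := h.2 ((φ b).symm ⟨Finsupp.single i 1, Finsupp.single_mem_supported _ _ hb⟩)
    have h₁ := hφ a b hab x
    rw [hx, LinearEquiv.apply_symm_apply] at h₁
    have h₂ := DFunLike.congr_fun (congrArg Subtype.val h₁) i
    simp only at h₂
    rw [Finsupp.restrictDom_apply, Finsupp.filter_apply, Finsupp.single_eq_same,
      if_pos (show i ∈ {i | b ∈ B.bar i} from hb)] at h₂
    refine (φ a x).2 (Finsupp.mem_support_iff.2 ?_)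
    rw [← h₂]
    exact one_ne_zero

/-- The module `M` changes only at the finitely many values in `V`. -/
structure PersistenceModule.Tame (M : PersistenceModule 𝕜) (V : Finset ℝ) : Prop where
  finiteDimensional : ∀ a, FiniteDimensional 𝕜 (M.obj a)
  bijective : ∀ {a b : ℝ} (hab : a ≤ b), (∀ v ∈ V, v ≤ b → v ≤ a) → Function.Bijective (M.map hab)
  subsingleton : ∀ a, (∀ v ∈ V, a < v) → Subsingleton (M.obj a)

variable {V : Finset ℝ}

/-- Membership is constant from a critical value up to the next one, so a bar is determined by its
trace on `V`. -/
theorem PersistenceModule.Tame.mem_bar_iff (hM : M.Tame V) (hB : M.HasBarcode B) (i : B.index)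
    (a : ℝ) : a ∈ B.bar i ↔ ∃ v ∈ V, v ≤ a ∧ (∀ w ∈ V, w ≤ a → w ≤ v) ∧ v ∈ B.bar i := by
  classical
  by_cases h : (V.filter (· ≤ a)).Nonempty
  · have hm := Finset.max'_mem _ h
    set v := (V.filter (· ≤ a)).max' h
    have hmax : ∀ w ∈ V, w ≤ a → w ≤ v := fun w hw hwa =>
      Finset.le_max' _ _ (Finset.mem_filter.2 ⟨hw, hwa⟩)
    rw [Finset.mem_filter] at hm
    rw [← hB.mem_iff_of_bijective hm.2 (hM.bijective hm.2 hmax) i]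
    constructor
    · exact fun hv => ⟨v, hm.1, hm.2, hmax, hv⟩
    · rintro ⟨w, hw, hwa, hwm, hwi⟩
      rwa [le_antisymm (hwm v hm.1 hm.2) (hmax w hw hwa)]
  · constructor
    · intro ha
      have := hM.subsingleton a fun v hv => by
        by_contra hc
        exact h ⟨v, Finset.mem_filter.2 ⟨hv, not_lt.1 hc⟩⟩
      obtain ⟨φ, -⟩ := hB
      have h₁ : (⟨Finsupp.single i 1, Finsupp.single_mem_supported _ _ ha⟩ :
          Finsupp.supported 𝕜 𝕜 {i | a ∈ B.bar i}) = 0 :=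
        (φ a).symm.injective (Subsingleton.elim _ _)
      have h₂ := DFunLike.congr_fun (congrArg Subtype.val h₁) i
      simp at h₂
    · rintro ⟨v, hv, hva, -⟩
      exact absurd ⟨v, Finset.mem_filter.2 ⟨hv, hva⟩⟩ h

theorem PersistenceModule.Tame.finite_index (hM : M.Tame V) (hB : M.HasBarcode B) :
    Finite B.index := by
  have h : (⋃ v ∈ V, {i | v ∈ B.bar i}).Finite := V.finite_toSet.biUnion fun v _ => by
    have := hM.finiteDimensional v
    exact hB.finite_alive v
  rw [← Set.finite_univ_iff]
  refine h.subset fun i _ => ?_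
  obtain ⟨a, ha⟩ := B.nonempty i
  obtain ⟨v, hv, -, -, hvi⟩ := (hM.mem_bar_iff hB i a).1 ha
  simp only [Set.mem_iUnion]
  exact ⟨v, hv, hvi⟩

/-- A bar contains `J ⊆ V` iff it contains the minimum and maximum of `J`, so the number of such
bars is a rank of `M`. These counts determine the multiset of traces on `V`, hence the bars. -/
theorem PersistenceModule.Tame.barcode_unique (hM : M.Tame V) (hB : M.HasBarcode B)
    (hC : M.HasBarcode C) : ∃ e : B.index ≃ C.index, ∀ i, C.bar (e i) = B.bar i := by
  classical
  have := hM.finite_index hB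
  have := hM.finite_index hC
  have := Fintype.ofFinite B.index
  have := Fintype.ofFinite C.index
  have ne : ∀ {B : Barcode}, M.HasBarcode B → ∀ i, (V.filter (· ∈ B.bar i)).Nonempty := by
    intro B hB i
    obtain ⟨a, ha⟩ := B.nonempty i
    obtain ⟨v, hv, -, -, hvi⟩ := (hM.mem_bar_iff hB i a).1 ha
    exact ⟨v, Finset.mem_filter.2 ⟨hv, hvi⟩⟩
  have sub : ∀ (B : Barcode) (J : Finset ℝ) (hJ : J.Nonempty), J ⊆ V → ∀ i,
      J ⊆ V.filter (· ∈ B.bar i) ↔ J.min' hJ ∈ B.bar i ∧ J.max' hJ ∈ B.bar i := by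
    intro B J hJ hJV i
    constructor
    · intro h
      exact ⟨(Finset.mem_filter.1 (h (J.min'_mem hJ))).2,
        (Finset.mem_filter.1 (h (J.max'_mem hJ))).2⟩
    · intro h v hv
      exact Finset.mem_filter.2 ⟨hJV hv,
        (B.ordConnected i).out h.1 h.2 ⟨J.min'_le v hv, J.le_max' v hv⟩⟩
  obtain ⟨e, he⟩ := exists_equiv_of_card_superset_eq V (fun i => V.filter (· ∈ B.bar i))
    (fun j => V.filter (· ∈ C.bar j)) (fun i => Finset.filter_subset _ _)
    (fun j => Finset.filter_subset _ _) (ne hB) (ne hC) (by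
      intro J hJ hJV
      have h₁ := hB.card_alive_eq hC (J.min'_le_max' hJ)
      rw [← Fintype.card_subtype, ← Fintype.card_subtype, ← Nat.card_eq_fintype_card,
        ← Nat.card_eq_fintype_card]
      simp only [sub _ J hJ hJV]
      exact h₁)
  refine ⟨e, fun i => ?_⟩
  have hv : ∀ v ∈ V, v ∈ C.bar (e i) ↔ v ∈ B.bar i := fun v hv => by
    have := congrArg (v ∈ ·) (he i)
    simpa [hv] using this
  ext a
  rw [hM.mem_bar_iff hC, hM.mem_bar_iff hB]
  refine exists_congr fun v => and_congr_right fun h => ?_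
  rw [hv v h]

end Uniqueness

/-! ### Sublevel set persistence is tame -/

namespace CubicalComplex.MonotoneFunction

variable {d : ℕ} {K : CubicalComplex d} (𝕜 : Type u) [Field 𝕜]

theorem _root_.ElemCube.homologyMap_bijective {X Y : Set (ElemCube d)} (h : X ⊆ Y) (e : X = Y)
    (k : ℕ) : Function.Bijective (ElemCube.homologyMap 𝕜 h k) := by
  subst e
  have : ElemCube.homologyMap 𝕜 h k = LinearMap.id := Submodule.linearMap_qext _ rfl
  rw [this]
  exact Function.bijective_id

theorem exists_tame (h : K.MonotoneFunction) (k : ℕ) :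
    ∃ V, (h.persistentHomology 𝕜 k).Tame V := by
  classical
  refine ⟨(K.finite.image h.val).toFinset, ?_, ?_, ?_⟩
  · intro a
    have hfin : {σ | σ ∈ h.sublevel a ∧ σ.dim = k}.Finite :=
      K.finite.subset fun σ hσ => (h.mem_sublevel.1 hσ.1).1
    have := hfin.fintype
    have h₁ : FiniteDimensional 𝕜 (ElemCube.chains 𝕜 (h.sublevel a) k) :=
      Module.Finite.equiv (Finsupp.supportedEquivFinsupp (M := 𝕜) (R := 𝕜) _).symm
    have h₂ : FiniteDimensional 𝕜 (ElemCube.cycles 𝕜 (h.sublevel a) k) :=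
      Submodule.finiteDimensional_of_le inf_le_left
    exact inferInstanceAs (FiniteDimensional 𝕜 (ElemCube.Homology 𝕜 (h.sublevel a) k))
  · intro a b hab hV
    refine ElemCube.homologyMap_bijective 𝕜 (h.sublevel_mono hab) ?_ k
    refine (h.sublevel_mono hab).antisymm fun σ hσ => ?_
    rw [h.mem_sublevel] at hσ ⊢
    exact ⟨hσ.1, hV _ (by simpa using ⟨σ, hσ.1, rfl⟩) hσ.2⟩
  · intro a hV
    have he : h.sublevel a = ∅ := by
      refine Set.eq_empty_of_forall_notMem fun σ hσ => ?_
      rw [h.mem_sublevel] at hσ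
      exact absurd (hV (h.val σ) (by simpa using ⟨σ, hσ.1, rfl⟩)) (not_lt.2 hσ.2)
    have h₁ : Subsingleton (ElemCube.cycles 𝕜 (h.sublevel a) k) := by
      refine ⟨fun x y => ?_⟩
      have hz : ∀ x ∈ ElemCube.cycles 𝕜 (h.sublevel a) k, x = 0 := by
        intro x hx
        rw [← Finsupp.support_eq_empty, Finset.eq_empty_iff_forall_notMem]
        intro σ hσ
        have := (hx.1 hσ).1
        rw [he] at this
        exact this
      exact Subtype.ext ((hz _ x.2).trans (hz _ y.2).symm)
    exact (Submodule.Quotient.mk_surjective _).subsingleton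

end CubicalComplex.MonotoneFunction

/-! ### The `ℓ^p` norm of families of extended nonnegative numbers -/

section EllNorm

variable {p : ℝ≥0∞} {ι κ : Type*}

theorem one_le_toReal_of_one_le (hp : 1 ≤ p) (h : p ≠ ∞) : 1 ≤ p.toReal := by
  rw [← ENNReal.toReal_one]
  exact ENNReal.toReal_mono h hp

theorem ellNorm_top (u : ι → ℝ≥0∞) : ellNorm ∞ u = ⨆ i, u i := if_pos rfl

theorem ellNorm_of_ne_top (h : p ≠ ∞) (u : ι → ℝ≥0∞) :
    ellNorm p u = (∑' i, u i ^ p.toReal) ^ (1 / p.toReal) := if_neg h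

/-- A charging argument: each nonzero entry of `u` is charged to an entry of `v` at least as large,
and no entry of `v` is charged twice. -/
theorem ellNorm_le_of_rel (hp : 1 ≤ p) {u : ι → ℝ≥0∞} {v : κ → ℝ≥0∞} (R : ι → κ → Prop)
    (hR : ∀ i i' j, R i j → R i' j → i = i') (h : ∀ i, u i ≠ 0 → ∃ j, R i j ∧ u i ≤ v j) :
    ellNorm p u ≤ ellNorm p v := by
  rcases eq_or_ne p ∞ with rfl | hp'
  · rw [ellNorm_top, ellNorm_top]
    refine iSup_le fun i => ?_
    by_cases hi : u i = 0
    · simp [hi]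
    · obtain ⟨j, -, hj⟩ := h i hi
      exact le_iSup_of_le j hj
  · have hr := one_le_toReal_of_one_le hp hp'
    rw [ellNorm_of_ne_top hp', ellNorm_of_ne_top hp']
    refine ENNReal.rpow_le_rpow ?_ (by positivity)
    choose j hj using fun i : {i // u i ≠ 0} => h i.1 i.2
    have hinj : Function.Injective j := fun i i' he =>
      Subtype.ext (hR _ _ _ (hj i).1 (he ▸ (hj i').1))
    calc ∑' i, u i ^ p.toReal = ∑' i : {i | u i ≠ 0}, u i ^ p.toReal := by
          refine (tsum_subtype_eq_of_support_subset (f := fun i => u i ^ p.toReal) ?_).symm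
          intro i hi h0
          exact hi (by simp only [h0]; exact ENNReal.zero_rpow_of_pos (by linarith))
      _ ≤ ∑' i : {i // u i ≠ 0}, v (j i) ^ p.toReal :=
          ENNReal.tsum_le_tsum fun i => ENNReal.rpow_le_rpow (hj i).2 (by linarith)
      _ ≤ ∑' i, v i ^ p.toReal :=
          ENNReal.tsum_comp_le_tsum_of_injective hinj fun i => v i ^ p.toReal

theorem ellNorm_mono (hp : 1 ≤ p) {u v : ι → ℝ≥0∞} (h : ∀ i, u i ≤ v i) :
    ellNorm p u ≤ ellNorm p v :=
  ellNorm_le_of_rel hp Eq (fun _ _ _ h h' => h.trans h'.symm) fun i _ => ⟨i, rfl, h i⟩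

theorem ellNorm_sigma (hp : 1 ≤ p) {β : κ → Type*} (u : ∀ k, β k → ℝ≥0∞) :
    ellNorm p (fun k => ellNorm p (u k)) = ellNorm p fun x : Σ k, β k => u x.1 x.2 := by
  rcases eq_or_ne p ∞ with rfl | hp'
  · simp only [ellNorm_top, iSup_sigma]
  · have hr := one_le_toReal_of_one_le hp hp'
    simp only [ellNorm_of_ne_top hp']
    rw [ENNReal.tsum_sigma (fun k i => u k i ^ p.toReal)]
    congr 2
    ext k
    rw [← ENNReal.rpow_mul, one_div_mul_cancel (by linarith), ENNReal.rpow_one]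

theorem ellNorm_add_le (hp : 1 ≤ p) [Finite ι] (u v : ι → ℝ≥0∞) :
    ellNorm p (fun i => u i + v i) ≤ ellNorm p u + ellNorm p v := by
  have := Fintype.ofFinite ι
  rcases eq_or_ne p ∞ with rfl | hp'
  · simp only [ellNorm_top]
    exact iSup_le fun i => add_le_add (le_iSup u i) (le_iSup v i)
  · simp only [ellNorm_of_ne_top hp', tsum_fintype]
    exact ENNReal.Lp_add_le _ _ _ (one_le_toReal_of_one_le hp hp')

theorem ellNorm_const_mul (hp : 1 ≤ p) (c : ℝ≥0∞) (u : ι → ℝ≥0∞) :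
    ellNorm p (fun i => c * u i) = c * ellNorm p u := by
  rcases eq_or_ne p ∞ with rfl | hp'
  · simp only [ellNorm_top, ENNReal.mul_iSup]
  · have hr := one_le_toReal_of_one_le hp hp'
    simp only [ellNorm_of_ne_top hp', ENNReal.mul_rpow_of_nonneg _ _ (zero_le_one.trans hr),
      ENNReal.tsum_mul_left]
    rw [ENNReal.mul_rpow_of_nonneg _ _ (by positivity), ← ENNReal.rpow_mul,
      mul_one_div_cancel (by linarith), ENNReal.rpow_one]

end EllNorm

/-! ### Distances in the extended plane -/

section PointDist

theorem coordDist_self (x : EReal) : coordDist x x = 0 := if_pos rfl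

theorem coordDist_coe (x y : ℝ) : coordDist x y = ENNReal.ofReal |x - y| := by
  unfold coordDist
  split_ifs with h
  · rw [EReal.coe_eq_coe_iff] at h
    simp [h]
  · rw [← EReal.coe_sub, EReal.abs_def]

theorem coordDist_comm (x y : EReal) : coordDist x y = coordDist y x := by
  induction x <;> induction y <;> first | simp [coordDist]; done | simp [coordDist_coe, abs_sub_comm]

theorem coordDist_triangle (x y z : EReal) : coordDist x z ≤ coordDist x y + coordDist y z := by
  induction x <;> induction y <;> induction z <;> try (simp [coordDist]; done)
  rename_i x y z
  rw [coordDist_coe, coordDist_coe, coordDist_coe, ← ENNReal.ofReal_add (abs_nonneg _) (abs_nonneg _)]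
  exact ENNReal.ofReal_le_ofReal (abs_sub_le _ _ _)

variable {p : ℝ≥0∞}

theorem pointDist_comm (x y : EReal × EReal) : pointDist p x y = pointDist p y x := by
  simp only [pointDist, coordDist_comm]

theorem pointDist_triangle (hp : 1 ≤ p) (x y z : EReal × EReal) :
    pointDist p x z ≤ pointDist p x y + pointDist p y z := by
  refine le_trans (ellNorm_mono hp fun i => ?_) (ellNorm_add_le hp _ _)
  fin_cases i
  · exact coordDist_triangle _ _ _
  · exact coordDist_triangle _ _ _

/-- A point of the plane on the diagonal. -/
def IsDiag (x : EReal × EReal) : Prop := ∃ t : ℝ, x = ((t : EReal), (t : EReal))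

theorem diagDist_le {x y : EReal × EReal} (hy : IsDiag y) : diagDist p x ≤ pointDist p x y := by
  obtain ⟨t, rfl⟩ := hy
  exact iInf_le _ t

end PointDist

/-! ### Couplings of graded barcodes -/

theorem exists_pequiv_of_injective {α β γ : Type*} {f : α → γ} {g : β → γ}
    (hf : Function.Injective f) (hg : Function.Injective g) :
    ∃ m : α ≃. β, ∀ a b, m a = some b ↔ f a = g b := by
  classical
  let F : α → Option β := fun a => if h : ∃ b, f a = g b then some h.choose else none
  let G : β → Option α := fun b => if h : ∃ a, f a = g b then some h.choose else none
  have hF : ∀ a b, F a = some b ↔ f a = g b := by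
    intro a b
    by_cases h : ∃ b, f a = g b
    · simp only [F, dif_pos h, Option.some.injEq]
      exact ⟨fun e => e ▸ h.choose_spec, fun e => hg (h.choose_spec.symm.trans e)⟩
    · simp only [F, dif_neg h, reduceCtorEq, false_iff]
      exact fun e => h ⟨b, e⟩
  have hG : ∀ a b, G b = some a ↔ f a = g b := by
    intro a b
    by_cases h : ∃ a, f a = g b
    · simp only [G, dif_pos h, Option.some.injEq]
      exact ⟨fun e => e ▸ h.choose_spec, fun e => hf (h.choose_spec.trans e.symm)⟩
    · simp only [G, dif_neg h, reduceCtorEq, false_iff]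
      exact fun e => h ⟨a, e⟩
  exact ⟨⟨F, G, fun a b => (hG a b).trans (hF a b).symm⟩, hF⟩

/-- The points of the family `u` that are not on the diagonal are the points of the graded
diagram `D`, by means of `φ`. -/
structure Tracks {ι : Type} (deg : ι → ℕ) (u : ι → EReal × EReal) (D : ℕ → Barcode)
    (φ : (Σ k, (D k).index) → ι) : Prop where
  injective : Function.Injective φ
  not_isDiag_iff : ∀ i, ¬ IsDiag (u i) ↔ ∃ x, φ x = i
  point : ∀ x, u (φ x) = (D x.1).point x.2
  degree : ∀ x, deg (φ x) = x.1

/-- Enlarging the index set is harmless as long as only diagonal points are added. -/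
theorem Tracks.comp {ι J : Type} {deg : ι → ℕ} {u : ι → EReal × EReal} {D : ℕ → Barcode}
    {φ : (Σ k, (D k).index) → ι} (h : Tracks deg u D φ) {α : ι → J} (hα : Function.Injective α)
    {deg' : J → ℕ} {u' : J → EReal × EReal} (hdeg : ∀ i, deg' (α i) = deg i)
    (hu : ∀ i, u' (α i) = u i) (hd : ∀ j, (∃ i, α i = j) ∨ IsDiag (u' j)) :
    Tracks deg' u' D (α ∘ φ) where
  injective := hα.comp h.injective
  not_isDiag_iff j := by
    constructor
    · intro hj
      obtain ⟨i, rfl⟩ := (hd j).resolve_right hj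
      rw [hu, h.not_isDiag_iff] at hj
      obtain ⟨x, rfl⟩ := hj
      exact ⟨x, rfl⟩
    · rintro ⟨x, rfl⟩
      rw [Function.comp_apply, hu, h.not_isDiag_iff]
      exact ⟨x, rfl⟩
  point x := (hu _).trans (h.point x)
  degree x := (hdeg _).trans (h.degree x)

/-- A tracked family splits into the points of the diagram and points of the diagonal. -/
def Tracks.equiv {ι : Type} {deg : ι → ℕ} {u : ι → EReal × EReal} {D : ℕ → Barcode}
    {φ : (Σ k, (D k).index) → ι} (h : Tracks deg u D φ) :
    (Σ k, (D k).index) ⊕ {i // IsDiag (u i)} ≃ ι :=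
  Equiv.ofBijective (Sum.elim φ Subtype.val) <| by
    constructor
    · refine Function.Injective.sumElim h.injective Subtype.val_injective fun x i he => ?_
      exact (h.not_isDiag_iff _).2 ⟨x, he⟩ i.2
    · intro i
      by_cases hi : IsDiag (u i)
      · exact ⟨Sum.inr ⟨i, hi⟩, rfl⟩
      · obtain ⟨x, hx⟩ := (h.not_isDiag_iff i).1 hi
        exact ⟨Sum.inl x, hx⟩

/-- The diagrams `D` and `E` are the off-diagonal points of two finite families of points whose
`ℓ^p` distance is at most `c`. -/
def Close (p : ℝ≥0∞) (D E : ℕ → Barcode) (c : ℝ≥0∞) : Prop :=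
  ∃ (ι : Type) (_ : Finite ι) (deg : ι → ℕ) (u v : ι → EReal × EReal)
    (φ : (Σ k, (D k).index) → ι) (ψ : (Σ k, (E k).index) → ι),
    Tracks deg u D φ ∧ Tracks deg v E ψ ∧ ellNorm p (fun i => pointDist p (u i) (v i)) ≤ c

theorem Close.mono {p : ℝ≥0∞} {D E : ℕ → Barcode} {c c' : ℝ≥0∞} (h : Close p D E c)
    (hc : c ≤ c') : Close p D E c' := by
  obtain ⟨ι, hι, deg, u, v, φ, ψ, hφ, hψ, hle⟩ := h
  exact ⟨ι, hι, deg, u, v, φ, ψ, hφ, hψ, hle.trans hc⟩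

/-- The two couplings are glued along the points of `E`, and Minkowski's inequality is applied to
the glued family. Keeping diagonal points in the families avoids composing partial matchings. -/
theorem Close.trans {p : ℝ≥0∞} (hp : 1 ≤ p) {D E F : ℕ → Barcode} {c c' : ℝ≥0∞}
    (h : Close p D E c) (h' : Close p E F c') : Close p D F (c + c') := by
  obtain ⟨ι, hι, deg, u, v, φ, ψ, hφ, hψ, hle⟩ := h
  obtain ⟨ι', hι', deg', u', v', φ', ψ', hφ', hψ', hle'⟩ := h'
  -- Besides the points of `E`, each coupling keeps its own pairs whose `E`-side is diagonal; such a
  -- pair costs nothing in the other coupling.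
  let J : Type := (Σ k, (E k).index) ⊕ ({i // IsDiag (v i)} ⊕ {i // IsDiag (u' i)})
  have : Finite (Σ k, (E k).index) := Finite.of_injective ψ hψ.injective
  let α : ι → J := fun i => Sum.map id Sum.inl (hψ.equiv.symm i)
  let α' : ι' → J := fun i => Sum.map id Sum.inr (hφ'.equiv.symm i)
  have hα : Function.Injective α :=
    (Sum.map_injective.2 ⟨Function.injective_id, Sum.inl_injective⟩).comp hψ.equiv.symm.injective
  have hα' : Function.Injective α' :=
    (Sum.map_injective.2 ⟨Function.injective_id, Sum.inr_injective⟩).comp hφ'.equiv.symm.injective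
  let degJ : J → ℕ := Sum.elim Sigma.fst (Sum.elim (fun i => deg i) fun i => deg' i)
  let uJ : J → EReal × EReal := Sum.elim (u ∘ ψ) (Sum.elim (fun i => u i) fun i => u' i)
  let vJ : J → EReal × EReal := Sum.elim (v' ∘ φ') (Sum.elim (fun i => v i) fun i => v' i)
  have T : Tracks degJ uJ D (α ∘ φ) := by
    refine hφ.comp hα (fun i => ?_) (fun i => ?_) ?_
    · obtain ⟨y, rfl⟩ := hψ.equiv.surjective i
      simp only [α, Equiv.symm_apply_apply]
      rcases y with y | y
      · exact (hψ.degree y).symm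
      · rfl
    · obtain ⟨y, rfl⟩ := hψ.equiv.surjective i
      simp only [α, Equiv.symm_apply_apply]
      rcases y with y | y <;> rfl
    · rintro (x | i | i)
      · exact Or.inl ⟨hψ.equiv (Sum.inl x), by simp [α]⟩
      · exact Or.inl ⟨hψ.equiv (Sum.inr i), by simp [α]⟩
      · exact Or.inr i.2
  have T' : Tracks degJ vJ F (α' ∘ ψ') := by
    refine hψ'.comp hα' (fun i => ?_) (fun i => ?_) ?_
    · obtain ⟨y, rfl⟩ := hφ'.equiv.surjective i
      simp only [α', Equiv.symm_apply_apply]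
      rcases y with y | y
      · exact (hφ'.degree y).symm
      · rfl
    · obtain ⟨y, rfl⟩ := hφ'.equiv.surjective i
      simp only [α', Equiv.symm_apply_apply]
      rcases y with y | y <;> rfl
    · rintro (x | i | i)
      · exact Or.inl ⟨hφ'.equiv (Sum.inl x), by simp [α']⟩
      · exact Or.inr i.2
      · exact Or.inl ⟨hφ'.equiv (Sum.inr i), by simp [α']⟩
  refine ⟨J, inferInstance, degJ, uJ, vJ, _, _, T, T', ?_⟩
  let A : J → ℝ≥0∞ := Sum.elim (fun x => pointDist p (u (ψ x)) (v (ψ x)))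
    (Sum.elim (fun i => pointDist p (u i) (v i)) 0)
  let A' : J → ℝ≥0∞ := Sum.elim (fun x => pointDist p (u' (φ' x)) (v' (φ' x)))
    (Sum.elim 0 (fun i => pointDist p (u' i) (v' i)))
  have hA : ellNorm p A ≤ c := by
    refine le_trans ?_ hle
    refine ellNorm_le_of_rel hp (fun j i => α i = j) (fun _ _ _ h h' => h.symm.trans h') ?_
    rintro (x | i | i) hne
    · exact ⟨hψ.equiv (Sum.inl x), by simp [α], le_rfl⟩
    · exact ⟨hψ.equiv (Sum.inr i), by simp [α], le_rfl⟩
    · exact absurd rfl hne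
  have hA' : ellNorm p A' ≤ c' := by
    refine le_trans ?_ hle'
    refine ellNorm_le_of_rel hp (fun j i => α' i = j) (fun _ _ _ h h' => h.symm.trans h') ?_
    rintro (x | i | i) hne
    · exact ⟨hφ'.equiv (Sum.inl x), by simp [α'], le_rfl⟩
    · exact absurd rfl hne
    · exact ⟨hφ'.equiv (Sum.inr i), by simp [α'], le_rfl⟩
  refine le_trans (ellNorm_mono hp ?_) ((ellNorm_add_le hp A A').trans (add_le_add hA hA'))
  rintro (x | i | i)
  · refine (pointDist_triangle hp (u (ψ x)) (v (ψ x)) (v' (φ' x))).trans_eq ?_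
    rw [show pointDist p (v (ψ x)) (v' (φ' x)) = pointDist p (u' (φ' x)) (v' (φ' x)) by
      rw [hψ.point, hφ'.point]]
    rfl
  · exact le_self_add
  · exact le_add_self

/-- In each degree, match the points that share an index of the coupling. An index used by only one
diagram carries a diagonal point on the other side, which bounds the cost of leaving its point
unmatched. -/
theorem Close.totalWasserstein_le {p : ℝ≥0∞} (hp : 1 ≤ p) {D E : ℕ → Barcode} {c : ℝ≥0∞}
    (h : Close p D E c) : totalWasserstein p D E ≤ c := by
  obtain ⟨ι, hι, deg, u, v, φ, ψ, hφ, hψ, hle⟩ := h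
  refine le_trans ?_ hle
  have hk : ∀ k, wasserstein p (D k) (E k) ≤
      ellNorm p fun i : {i // deg i = k} => pointDist p (u i) (v i) := by
    intro k
    have hDk : Function.Injective fun x : (D k).index => φ ⟨k, x⟩ :=
      hφ.injective.comp sigma_mk_injective
    have hEk : Function.Injective fun y : (E k).index => ψ ⟨k, y⟩ :=
      hψ.injective.comp sigma_mk_injective
    obtain ⟨m, hm⟩ := exists_pequiv_of_injective hDk hEk
    refine (iInf_le _ m).trans ?_
    refine ellNorm_le_of_rel hp (fun j i => Sum.elim (fun x => φ ⟨k, x⟩ = i.1)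
      (fun y => ψ ⟨k, y⟩ = i.1 ∧ m.symm y = none) j) ?_ ?_
    · rintro (x | y) (x' | y') i h h'
      · exact congrArg Sum.inl (hDk (h.trans h'.symm))
      · have := (m.eq_some_iff).2 ((hm x y').2 (h.trans h'.1.symm))
        rw [h'.2] at this
        cases this
      · have := (m.eq_some_iff).2 ((hm x' y).2 (h'.trans h.1.symm))
        rw [h.2] at this
        cases this
      · exact congrArg Sum.inr (hEk (h.1.trans h'.1.symm))
    · rintro (x | y) hne
      · refine ⟨⟨φ ⟨k, x⟩, hφ.degree _⟩, rfl, ?_⟩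
        simp only [Sum.elim_inl]
        rw [hφ.point]
        rcases hmx : m x with _ | y
        · refine diagDist_le ?_
          by_contra hc
          obtain ⟨⟨l, y⟩, hy⟩ := (hψ.not_isDiag_iff _).1 hc
          have hl : l = k := (hψ.degree ⟨l, y⟩).symm.trans (hy ▸ hφ.degree ⟨k, x⟩)
          subst hl
          rw [(hm x y).2 hy.symm] at hmx
          cases hmx
        · have := (hm x y).1 hmx
          rw [this, hψ.point]
          rfl
      · rcases hmy : m.symm y with _ | x
        · refine ⟨⟨ψ ⟨k, y⟩, hψ.degree _⟩, ⟨rfl, hmy⟩, ?_⟩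
          simp only [Sum.elim_inr, hmy]
          rw [hψ.point, pointDist_comm]
          refine diagDist_le ?_
          by_contra hc
          obtain ⟨⟨l, x⟩, hx⟩ := (hφ.not_isDiag_iff _).1 hc
          have hl : l = k := (hφ.degree ⟨l, x⟩).symm.trans (hx ▸ hψ.degree ⟨k, y⟩)
          subst hl
          rw [(m.eq_some_iff).2 ((hm x y).2 hx)] at hmy
          cases hmy
        · simp [hmy] at hne
  refine (ellNorm_mono hp hk).trans ?_
  rw [ellNorm_sigma hp (fun k (i : {i // deg i = k}) => pointDist p (u i) (v i))]
  refine ellNorm_le_of_rel hp (fun x i => x.2.1 = i) ?_ fun x _ => ⟨_, rfl, le_rfl⟩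
  rintro ⟨k, i, rfl⟩ ⟨k', i', rfl⟩ j rfl h'
  cases h'
  rfl

/-! ### Stability along a common normal form -/

section EndPoints

theorem sInf_coe_image_eq {s : Set ℝ} {a : ℝ} (h : IsLeast s a) :
    sInf ((fun t : ℝ => (t : EReal)) '' s) = a :=
  (EReal.coe_strictMono.monotone.map_isLeast h).isGLB.sInf_eq

theorem sSup_coe_image_Ico {a b : ℝ} (h : a < b) :
    sSup ((fun t : ℝ => (t : EReal)) '' Set.Ico a b) = b := by
  refine IsLUB.sSup_eq ⟨?_, fun c hc => ?_⟩
  · rintro _ ⟨t, ht, rfl⟩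
    exact EReal.coe_le_coe_iff.2 ht.2.le
  · by_contra hcb
    obtain ⟨w, hw₁, hw₂⟩ := EReal.exists_between_coe_real
      (max_lt (not_le.1 hcb) (EReal.coe_lt_coe_iff.2 h))
    refine absurd (hc ⟨w, ⟨?_, EReal.coe_lt_coe_iff.1 hw₂⟩, rfl⟩)
      (not_le.2 ((le_max_left _ _).trans_lt hw₁))
    exact EReal.coe_le_coe_iff.1 ((le_max_right _ _).trans hw₁.le)

theorem sSup_coe_image_Ici (a : ℝ) :
    sSup ((fun t : ℝ => (t : EReal)) '' Set.Ici a) = ⊤ := by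
  rw [EReal.eq_top_iff_forall_lt]
  intro y
  exact lt_of_lt_of_le (EReal.coe_lt_coe_iff.2 (lt_of_lt_of_le (lt_add_one y) (le_max_right a _)))
    (le_sSup ⟨max a (y + 1), Set.mem_Ici.2 (le_max_left _ _), rfl⟩)

end EndPoints

namespace NormalForm

variable {d : ℕ} {𝕜 : Type*} [Field 𝕜] {K : CubicalComplex d} (N : NormalForm 𝕜 K)

open scoped Classical in
/-- The point of the diagram, possibly on the diagonal, given by a basis element. -/
def point (h : K.MonotoneFunction) (τ : ElemCube d) : EReal × EReal :=
  (h.val τ, if hσ : ∃ σ ∈ K.cells, N.low σ = some τ then (h.val hσ.choose : EReal) else ⊤)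

variable {N}

theorem point_of_low (h : K.MonotoneFunction) {σ τ : ElemCube d} (hσ : σ ∈ K.cells)
    (hl : N.low σ = some τ) : N.point h τ = ((h.val τ : EReal), (h.val σ : EReal)) := by
  have hex : ∃ σ ∈ K.cells, N.low σ = some τ := ⟨σ, hσ, hl⟩
  simp only [point, dif_pos hex]
  rw [N.low_inj _ hex.choose_spec.1 σ hσ τ hex.choose_spec.2 hl]

theorem point_of_essential (h : K.MonotoneFunction) {τ : ElemCube d}
    (hτ : ¬ ∃ σ ∈ K.cells, N.low σ = some τ) : N.point h τ = ((h.val τ : EReal), ⊤) := by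
  simp only [point, dif_neg hτ]

theorem lifetime_of_low (h : K.MonotoneFunction) {σ τ : ElemCube d} (hσ : σ ∈ K.cells)
    (hl : N.low σ = some τ) : N.lifetime h τ = Set.Ico (h.val τ) (h.val σ) := by
  ext a
  refine and_congr_right fun _ => ⟨fun H => H σ hσ hl, fun H ρ hρ hρl => ?_⟩
  rwa [N.low_inj ρ hρ σ hσ τ hρl hl]

theorem lifetime_of_essential (h : K.MonotoneFunction) {τ : ElemCube d}
    (hτ : ¬ ∃ σ ∈ K.cells, N.low σ = some τ) : N.lifetime h τ = Set.Ici (h.val τ) := by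
  ext a
  exact and_iff_left fun σ hσ hl => absurd ⟨σ, hσ, hl⟩ hτ

theorem not_isDiag_point_iff {h : K.MonotoneFunction} (hN : N.Compatible h) (τ : ElemCube d) :
    ¬ IsDiag (N.point h τ) ↔ (N.lifetime h τ).Nonempty := by
  by_cases hτ : ∃ σ ∈ K.cells, N.low σ = some τ
  · obtain ⟨σ, hσ, hl⟩ := hτ
    rw [point_of_low h hσ hl, lifetime_of_low h hσ hl, Set.nonempty_Ico]
    constructor
    · intro H
      refine lt_of_le_of_ne (hN.low_le σ hσ τ hl) fun e => H ⟨h.val τ, ?_⟩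
      rw [e]
    · rintro H ⟨t, ht⟩
      simp only [Prod.mk.injEq, EReal.coe_eq_coe_iff] at ht
      exact H.ne (ht.1.trans ht.2.symm)
  · rw [point_of_essential h hτ, lifetime_of_essential h hτ]
    refine iff_of_true ?_ Set.nonempty_Ici
    rintro ⟨t, ht⟩
    simp only [Prod.mk.injEq] at ht
    exact EReal.coe_ne_top t ht.2.symm

theorem point_eq_of_bar {h : K.MonotoneFunction} {B : Barcode} (i : B.index) {τ : ElemCube d}
    (hB : B.bar i = N.lifetime h τ) : B.point i = N.point h τ := by
  have hne := B.nonempty i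
  unfold Barcode.point Barcode.birth Barcode.death
  rw [hB] at hne ⊢
  by_cases hτ : ∃ σ ∈ K.cells, N.low σ = some τ
  · obtain ⟨σ, hσ, hl⟩ := hτ
    rw [lifetime_of_low h hσ hl] at hne ⊢
    rw [Set.nonempty_Ico] at hne
    rw [point_of_low h hσ hl, sInf_coe_image_eq (isLeast_Ico hne), sSup_coe_image_Ico hne]
  · rw [point_of_essential h hτ, lifetime_of_essential h hτ, sInf_coe_image_eq isLeast_Ici,
      sSup_coe_image_Ici]

/-- Uniqueness of barcodes carries the explicit diagram of the normal form over to the given `D`.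
Basis cycles with empty lifetime are the diagonal points. -/
theorem exists_tracks {h : K.MonotoneFunction} (hN : N.Compatible h) {D : ℕ → Barcode}
    (hD : h.HasDiagram 𝕜 D) :
    ∃ φ : (Σ k, (D k).index) → {τ // τ ∈ K.cells ∧ N.low τ = none},
      Tracks (fun τ => τ.1.dim) (fun τ => N.point h τ.1) D φ := by
  have key : ∀ k, ∃ e : (D k).index ≃ (N.barcode h k).index,
      ∀ i, (N.barcode h k).bar (e i) = (D k).bar i := by
    intro k
    obtain ⟨V, hV⟩ := h.exists_tame 𝕜 k
    exact hV.barcode_unique (hD k) (hasBarcode hN k)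
  choose e he using key
  have hdim : ∀ k (x : (D k).index), (e k x).1.dim = k := fun k x => (e k x).2.2.1
  refine ⟨fun x => ⟨(e x.1 x.2).1, (e x.1 x.2).2.1, (e x.1 x.2).2.2.2.1⟩, ?_, ?_, ?_, ?_⟩
  · rintro ⟨k, x⟩ ⟨l, y⟩ hxy
    have hxy' : (e k x).1 = (e l y).1 := congrArg Subtype.val hxy
    have hkl : k = l := by rw [← hdim k x, ← hdim l y, hxy']
    subst hkl
    rw [(e k).injective (Subtype.ext hxy')]
  · intro τ
    rw [not_isDiag_point_iff hN]
    constructor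
    · intro hne
      refine ⟨⟨τ.1.dim, (e τ.1.dim).symm ⟨τ.1, τ.2.1, rfl, τ.2.2, hne⟩⟩, Subtype.ext ?_⟩
      have := (e τ.1.dim).apply_symm_apply ⟨τ.1, τ.2.1, rfl, τ.2.2, hne⟩
      exact congrArg (fun i : (N.barcode h τ.1.dim).index => i.1) this
    · rintro ⟨x, rfl⟩
      exact (e x.1 x.2).2.2.2.2
  · rintro ⟨k, x⟩
    exact (point_eq_of_bar x (he k x).symm).symm
  · rintro ⟨k, x⟩
    exact hdim k x

theorem close {p : ℝ≥0∞} (hp : 1 ≤ p) {h h' : K.MonotoneFunction} (hN : N.Compatible h)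
    (hN' : N.Compatible h') {D E : ℕ → Barcode} (hD : h.HasDiagram 𝕜 D)
    (hE : h'.HasDiagram 𝕜 E) :
    Close p D E (ellNorm p fun σ : K.cells => ENNReal.ofReal |h.toFun σ - h'.toFun σ|) := by
  obtain ⟨φ, hφ⟩ := exists_tracks hN hD
  obtain ⟨ψ, hψ⟩ := exists_tracks hN' hE
  have hfin : Finite {τ // τ ∈ K.cells ∧ N.low τ = none} :=
    K.finite.subset fun τ hτ => hτ.1
  refine ⟨_, hfin, _, _, _, φ, ψ, hφ, hψ, ?_⟩
  unfold pointDist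
  rw [ellNorm_sigma hp]
  -- Births are charged to `τ` and deaths to the `σ` that kills `τ`. A cell is never charged for
  -- both, because a birth needs `low` to be `none`.
  refine ellNorm_le_of_rel hp
    (fun x σ => if x.2 = 0 then σ.1 = x.1.1 else N.low σ.1 = some x.1.1) ?_ ?_
  · rintro ⟨τ, m⟩ ⟨τ', m'⟩ σ H H'
    have aux : ∀ τ : {τ // τ ∈ K.cells ∧ N.low τ = none}, ∀ τ' : ElemCube d,
        σ.1 = τ.1 → N.low σ.1 = some τ' → False := fun τ τ' h₁ h₂ => by
      rw [h₁, τ.2.2] at h₂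
      cases h₂
    fin_cases m <;> fin_cases m' <;> simp at H H' ⊢
    · exact Subtype.ext (H.symm.trans H')
    · exact aux τ _ H H'
    · exact aux τ' _ H' H
    · exact Subtype.ext (Option.some_injective _ (H.symm.trans H'))
  · rintro ⟨τ, m⟩ hne
    by_cases hτ : ∃ σ ∈ K.cells, N.low σ = some τ.1
    · obtain ⟨σ, hσ, hl⟩ := hτ
      fin_cases m
      · refine ⟨⟨τ.1, τ.2.1⟩, by simp, ?_⟩
        simp only [point_of_low h hσ hl, point_of_low h' hσ hl]
        simp [coordDist_coe, h.val_of_mem τ.2.1, h'.val_of_mem τ.2.1]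
      · refine ⟨⟨σ, hσ⟩, by simpa using hl, ?_⟩
        simp only [point_of_low h hσ hl, point_of_low h' hσ hl]
        simp [coordDist_coe, h.val_of_mem hσ, h'.val_of_mem hσ]
    · fin_cases m
      · refine ⟨⟨τ.1, τ.2.1⟩, by simp, ?_⟩
        simp only [point_of_essential h hτ, point_of_essential h' hτ]
        simp [coordDist_coe, h.val_of_mem τ.2.1, h'.val_of_mem τ.2.1]
      -- Both deaths are `⊤`, and `|∞ - ∞| = 0`.
      · refine absurd ?_ hne
        simp [point_of_essential h hτ, point_of_essential h' hτ, coordDist_self]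

end NormalForm

/-! ### Cellular stability -/

/-- Let `c` be the supremum of the points reachable from `0`. The local property at `c` makes `c`
itself reachable, and a point beyond it if `c < 1`. Only intervals with an end at the centre `t` are
needed, which is all that `exists_lineMap_order` yields. -/
theorem Icc_induction_of_local {Q : ℝ → ℝ → Prop}
    (htrans : ∀ t ∈ Set.Icc (0 : ℝ) 1, ∀ s u, s ≤ t → t ≤ u → Q s t → Q t u → Q s u)
    (hloc : ∀ t ∈ Set.Icc (0 : ℝ) 1, ∃ ε > 0, ∀ s ∈ Set.Icc (0 : ℝ) 1, |s - t| < ε →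
      (s ≤ t → Q s t) ∧ (t ≤ s → Q t s)) : Q 0 1 := by
  let S : Set ℝ := {t | t ∈ Set.Icc (0 : ℝ) 1 ∧ Q 0 t}
  have h01 : (0 : ℝ) ∈ Set.Icc (0 : ℝ) 1 := ⟨le_rfl, zero_le_one⟩
  have h0 : (0 : ℝ) ∈ S := by
    obtain ⟨ε, hε, H⟩ := hloc 0 h01
    exact ⟨h01, (H 0 h01 (by simpa using hε)).1 le_rfl⟩
  have hbdd : BddAbove S := ⟨1, fun t ht => ht.1.2⟩
  set c := sSup S
  have hc : c ∈ Set.Icc (0 : ℝ) 1 := ⟨le_csSup hbdd h0, csSup_le ⟨0, h0⟩ fun t ht => ht.1.2⟩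
  obtain ⟨ε, hε, H⟩ := hloc c hc
  obtain ⟨t, ht, hlt⟩ := exists_lt_of_lt_csSup ⟨0, h0⟩ (sub_lt_self c hε)
  have htc : t ≤ c := le_csSup hbdd ht
  have hQc : Q 0 c := htrans t ht.1 0 c ht.1.1 htc ht.2
    ((H t ht.1 (by rw [abs_sub_lt_iff]; constructor <;> linarith)).1 htc)
  rcases hc.2.eq_or_lt with h1 | h1
  · rwa [h1] at hQc
  · exfalso
    let s := min (c + ε / 2) 1
    have hcs : c < s := lt_min (by linarith) h1
    have hs : s ∈ Set.Icc (0 : ℝ) 1 := ⟨hc.1.trans hcs.le, min_le_right _ _⟩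
    have hsε : s ≤ c + ε / 2 := min_le_left _ _
    have : s ∈ S := ⟨hs, htrans c hc 0 s hc.1 hcs.le hQc
      ((H s hs (by rw [abs_sub_lt_iff]; constructor <;> linarith)).2 hcs.le)⟩
    exact absurd (le_csSup hbdd this) (not_le.2 hcs)

namespace CubicalComplex.MonotoneFunction

variable {d : ℕ} {K : CubicalComplex d}

theorem exists_hasDiagram (𝕜 : Type*) [Field 𝕜] (h : K.MonotoneFunction) :
    ∃ D, h.HasDiagram 𝕜 D := by
  obtain ⟨N, hN, -⟩ := exists_compatible_normalForm 𝕜 h h fun _ _ _ _ => id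
  exact ⟨fun k => N.barcode h k, NormalForm.hasBarcode hN⟩

/-- The straight-line homotopy between two monotone functions. -/
def lineMap (f g : K.MonotoneFunction) (t : Set.Icc (0 : ℝ) 1) : K.MonotoneFunction where
  toFun σ := (1 - t) * f.toFun σ + t * g.toFun σ
  monotone τ σ h := add_le_add
    (mul_le_mul_of_nonneg_left (f.monotone τ σ h) (sub_nonneg.2 t.2.2))
    (mul_le_mul_of_nonneg_left (g.monotone τ σ h) t.2.1)

theorem lineMap_zero (f g : K.MonotoneFunction) : f.lineMap g 0 = f := by
  cases f
  simp [lineMap]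

theorem lineMap_one (f g : K.MonotoneFunction) : f.lineMap g 1 = g := by
  cases g
  simp [lineMap]

/-- Finitely many strict inequalities between continuous functions of the parameter persist near
`t`. Ties at `t` may break either way, hence the one-sided conclusion. -/
theorem exists_lineMap_order (f g : K.MonotoneFunction) (t : Set.Icc (0 : ℝ) 1) :
    ∃ ε > 0, ∀ s : Set.Icc (0 : ℝ) 1, |(s : ℝ) - t| < ε → ∀ σ ∈ K.cells, ∀ τ ∈ K.cells,
      (f.lineMap g t).val σ < (f.lineMap g t).val τ →
      (f.lineMap g s).val σ < (f.lineMap g s).val τ := by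
  have : Finite K.cells := K.finite
  have key : ∀ᶠ s in nhds t, ∀ x : K.cells × K.cells,
      (f.lineMap g t).toFun x.1 < (f.lineMap g t).toFun x.2 →
      (f.lineMap g s).toFun x.1 < (f.lineMap g s).toFun x.2 := by
    rw [Filter.eventually_all]
    intro x
    by_cases hx : (f.lineMap g t).toFun x.1 < (f.lineMap g t).toFun x.2
    · have c : ∀ σ : K.cells, Continuous fun s => (f.lineMap g s).toFun σ := fun σ => by
        unfold lineMap
        fun_prop
      filter_upwards [(c x.1).continuousAt.eventually_lt (c x.2).continuousAt hx] with s hs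
      exact fun _ => hs
    · exact Filter.Eventually.of_forall fun s h => absurd h hx
  obtain ⟨ε, hε, H⟩ := Metric.eventually_nhds_iff.1 key
  refine ⟨ε, hε, fun s hs σ hσ τ hτ hlt => ?_⟩
  rw [val_of_mem _ hσ, val_of_mem _ hτ] at hlt ⊢
  exact H (y := s) hs (⟨σ, hσ⟩, ⟨τ, hτ⟩) hlt

theorem close_of_hasDiagram {𝕜 : Type*} [Field 𝕜] {p : ℝ≥0∞} (hp : 1 ≤ p)
    {f g : K.MonotoneFunction} {D E : ℕ → Barcode} (hD : f.HasDiagram 𝕜 D)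
    (hE : g.HasDiagram 𝕜 E) :
    Close p D E (ellNorm p fun σ : K.cells => ENNReal.ofReal |f.toFun σ - g.toFun σ|) := by
  set W := ellNorm p fun σ : K.cells => ENNReal.ofReal |f.toFun σ - g.toFun σ|
  -- The cost is linear in the parameter, so costs of adjacent intervals add up without loss.
  have hW : ∀ s t : Set.Icc (0 : ℝ) 1, ellNorm p (fun σ : K.cells =>
      ENNReal.ofReal |(f.lineMap g s).toFun σ - (f.lineMap g t).toFun σ|) =
      ENNReal.ofReal |(s : ℝ) - t| * W := by
    intro s t
    rw [← ellNorm_const_mul hp]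
    congr 1
    ext σ
    rw [← ENNReal.ofReal_mul (abs_nonneg _), ← abs_mul, ← abs_neg]
    congr 2
    simp only [lineMap]
    ring
  have main := Icc_induction_of_local (Q := fun s t => ∀ (hs : s ∈ Set.Icc (0 : ℝ) 1)
    (ht : t ∈ Set.Icc (0 : ℝ) 1) (D E : ℕ → Barcode), (f.lineMap g ⟨s, hs⟩).HasDiagram 𝕜 D →
      (f.lineMap g ⟨t, ht⟩).HasDiagram 𝕜 E → Close p D E (ENNReal.ofReal |s - t| * W)) ?_ ?_
  · have := main ⟨le_rfl, zero_le_one⟩ ⟨zero_le_one, le_rfl⟩ D E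
      (by rwa [← lineMap_zero f g] at hD) (by rwa [← lineMap_one f g] at hE)
    simpa using this
  · intro t ht s u hst htu h₁ h₂ hs hu D E hD hE
    obtain ⟨F, hF⟩ := exists_hasDiagram 𝕜 (f.lineMap g ⟨t, ht⟩)
    refine ((h₁ hs ht D F hD hF).trans hp (h₂ ht hu F E hF hE)).mono (le_of_eq ?_)
    rw [← add_mul, ← ENNReal.ofReal_add (abs_nonneg _) (abs_nonneg _),
      abs_of_nonpos (sub_nonpos.2 hst), abs_of_nonpos (sub_nonpos.2 htu),
      abs_of_nonpos (sub_nonpos.2 (hst.trans htu))]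
    congr 2
    ring
  · intro t ht
    obtain ⟨ε, hε, H⟩ := exists_lineMap_order f g ⟨t, ht⟩
    refine ⟨ε, hε, fun s hs hst => ?_⟩
    obtain ⟨N, hN, hN'⟩ := exists_compatible_normalForm 𝕜 _ _ (H ⟨s, hs⟩ hst)
    constructor
    · intro _ _ _ D E hD hE
      exact (NormalForm.close hp hN' hN hD hE).mono (hW ⟨s, hs⟩ ⟨t, ht⟩).le
    · intro _ _ _ D E hD hE
      exact (NormalForm.close hp hN hN' hD hE).mono (hW ⟨t, ht⟩ ⟨s, hs⟩).le

end CubicalComplex.MonotoneFunction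

/-! ### The two methods -/

section Numeric

theorem Finset.exists_abs_inf'_sub_inf'_le {ι : Type*} {s : Finset ι} (hs : s.Nonempty)
    (f g : ι → ℝ) : ∃ i ∈ s, |s.inf' hs f - s.inf' hs g| ≤ |f i - g i| := by
  obtain ⟨i, hi, hi'⟩ := s.exists_mem_eq_inf' hs f
  obtain ⟨j, hj, hj'⟩ := s.exists_mem_eq_inf' hs g
  rcases le_total (s.inf' hs f) (s.inf' hs g) with h | h
  · refine ⟨i, hi, ?_⟩
    have := Finset.inf'_le g hi
    rw [abs_of_nonpos (sub_nonpos.2 h), abs_sub_comm]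
    exact le_trans (by linarith) (le_abs_self _)
  · refine ⟨j, hj, ?_⟩
    have := Finset.inf'_le f hj
    rw [abs_of_nonneg (sub_nonneg.2 h)]
    exact le_trans (by linarith) (le_abs_self _)

theorem Finset.exists_abs_sup'_sub_sup'_le {ι : Type*} {s : Finset ι} (hs : s.Nonempty)
    (f g : ι → ℝ) : ∃ i ∈ s, |s.sup' hs f - s.sup' hs g| ≤ |f i - g i| := by
  obtain ⟨i, hi, hi'⟩ := s.exists_mem_eq_sup' hs f
  obtain ⟨j, hj, hj'⟩ := s.exists_mem_eq_sup' hs g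
  rcases le_total (s.sup' hs f) (s.sup' hs g) with h | h
  · refine ⟨j, hj, ?_⟩
    have := Finset.le_sup' f hj
    rw [abs_of_nonpos (sub_nonpos.2 h), abs_sub_comm]
    exact le_trans (by linarith) (le_abs_self _)
  · refine ⟨i, hi, ?_⟩
    have := Finset.le_sup' g hi
    rw [abs_of_nonneg (sub_nonneg.2 h)]
    exact le_trans (by linarith) (le_abs_self _)

variable {p : ℝ≥0∞}

/-- For finite `p` the exact factor is `card ι ^ (1 / p)`, which is at most `card ι`. -/
theorem ellNorm_const_le (hp : 1 ≤ p) {ι : Type*} [Fintype ι] [Nonempty ι] (c : ℝ≥0∞) :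
    ellNorm p (fun _ : ι => c) ≤ Fintype.card ι * c := by
  have hcard : (1 : ℝ≥0∞) ≤ Fintype.card ι := by exact_mod_cast Fintype.card_pos
  rcases eq_or_ne p ∞ with rfl | hp'
  · rw [ellNorm_top, ciSup_const]
    exact le_mul_of_one_le_left zero_le hcard
  · have hr := one_le_toReal_of_one_le hp hp'
    rw [ellNorm_of_ne_top hp', tsum_fintype, Finset.sum_const, nsmul_eq_mul, Finset.card_univ,
      ENNReal.mul_rpow_of_nonneg _ _ (by positivity), ← ENNReal.rpow_mul,
      mul_one_div_cancel (by linarith), ENNReal.rpow_one]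
    refine mul_le_mul_left ?_ _
    conv_rhs => rw [← ENNReal.rpow_one (Fintype.card ι : ℝ≥0∞)]
    exact ENNReal.rpow_le_rpow_of_exponent_le hcard ((div_le_one (by linarith)).2 hr)

theorem ellNorm_ofReal_le_norm (hp : 1 ≤ p) {ι : Type*} [Fintype ι] (f g : ι → ℝ) :
    ellNorm p (fun i => ENNReal.ofReal |f i - g i|) ≤
      ENNReal.ofReal ‖(WithLp.toLp p (f - g) : PiLp p fun _ : ι => ℝ)‖ := by
  rcases eq_or_ne p ∞ with rfl | hp'
  · rw [ellNorm_top, PiLp.norm_eq_ciSup]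
    refine iSup_le fun i => ENNReal.ofReal_le_ofReal ?_
    exact le_ciSup (f := fun i => ‖(WithLp.toLp ∞ (f - g) : PiLp ∞ fun _ : ι => ℝ) i‖)
      (Set.finite_range _).bddAbove i
  · have hr := one_le_toReal_of_one_le hp hp'
    rw [ellNorm_of_ne_top hp', tsum_fintype, PiLp.norm_eq_sum (by linarith),
      ← ENNReal.ofReal_rpow_of_nonneg (Finset.sum_nonneg fun i _ => by positivity) (by positivity),
      ENNReal.ofReal_sum_of_nonneg fun i _ => by positivity]
    refine le_of_eq ?_
    congr 2
    ext i
    rw [ENNReal.ofReal_rpow_of_nonneg (abs_nonneg _) (by linarith)]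
    rfl

theorem sum_two_pow_mul_choose (d : ℕ) :
    ∑ i ∈ Finset.range (d + 1), (2 : ℝ) ^ (d - i) * (d.choose i : ℝ) = 3 ^ d := by
  have := add_pow (1 : ℝ) 2 d
  norm_num at this
  rw [this]

end Numeric

namespace GrayscaleImage

variable {d : ℕ} {S : Finset (Fin d → ℤ)}

/-- A voxel is incident to a cell if it determines the value at that cell. -/
def Method.Incident (m : Method) (σ : ElemCube d) (v : Fin d → ℤ) : Prop :=
  match m with
  | .topCells => σ.IsFace (ElemCube.voxel v)
  | .dual => (ElemCube.vertex v).IsFace σ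

theorem Method.exists_incident (m : Method) (f g : S → ℝ) (σ : (m.complex S).cells) :
    ∃ v : S, m.Incident σ.1 v.1 ∧
      |(m.function f).toFun σ - (m.function g).toFun σ| ≤ |f v - g v| := by
  classical
  cases m with
  | topCells =>
    obtain ⟨w, hw, hf⟩ := σ.2
    obtain ⟨v, hv, h⟩ := Finset.exists_abs_inf'_sub_inf'_le
      (s := Finset.univ.filter fun v : S => σ.1.IsFace (ElemCube.voxel v.1))
      ⟨⟨w, hw⟩, Finset.mem_filter.2 ⟨Finset.mem_univ _, hf⟩⟩ f g
    exact ⟨v, (Finset.mem_filter.1 hv).2, h⟩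
  | dual =>
    have hf : (ElemCube.vertex σ.1.base).IsFace σ.1 :=
      ⟨Finset.empty_subset _, fun _ => Or.inl rfl⟩
    obtain ⟨v, hv, h⟩ := Finset.exists_abs_sup'_sub_sup'_le
      (s := Finset.univ.filter fun v : S => (ElemCube.vertex v.1).IsFace σ.1)
      ⟨⟨σ.1.base, σ.2 _ hf⟩, Finset.mem_filter.2 ⟨Finset.mem_univ _, hf⟩⟩ f g
    exact ⟨v, (Finset.mem_filter.1 hv).2, h⟩

open scoped Classical in
/-- The position of a cell relative to an incident voxel. -/
def position (σ : ElemCube d) (v : Fin d → ℤ) : Fin d → Fin 3 := fun i =>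
  if σ.base i = v i then (if i ∈ σ.dirs then 0 else 1) else 2

/-- When `σ.base i ≠ v i`, incidence forces the `i`-th factor: `{v i + 1}` for top cells, `[v i - 1,
v i]` for the dual. So three positions per direction suffice, giving at most `3 ^ d` incident cells.
-/
theorem Method.eq_of_position_eq (m : Method) {σ τ : ElemCube d} {v : Fin d → ℤ}
    (hσ : m.Incident σ v) (hτ : m.Incident τ v) (h : position σ v = position τ v) : σ = τ := by
  have key : ∀ i, σ.base i = τ.base i ∧ (i ∈ σ.dirs ↔ i ∈ τ.dirs) := by
    intro i
    have hi := congrFun h i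
    unfold position at hi
    cases m with
    | topCells =>
      have h₁ := hσ.2 i
      have h₂ := hτ.2 i
      simp only [ElemCube.voxel, Finset.mem_univ, true_and] at h₁ h₂
      grind
    | dual =>
      have h₁ := hσ.2 i
      have h₂ := hτ.2 i
      simp only [ElemCube.vertex, Finset.notMem_empty, not_false_eq_true, true_and] at h₁ h₂
      grind
  exact ElemCube.ext (funext fun i => (key i).1) (Finset.ext fun i => (key i).2)

theorem Method.ellNorm_function_sub_le (m : Method) {p : ℝ≥0∞} (hp : 1 ≤ p) (f g : S → ℝ) :
    ellNorm p (fun σ : (m.complex S).cells =>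
      ENNReal.ofReal |(m.function f).toFun σ - (m.function g).toFun σ|) ≤
      3 ^ d * ellNorm p fun v : S => ENNReal.ofReal |f v - g v| := by
  choose v hv hle using m.exists_incident f g
  have h₁ := ellNorm_const_le hp (ι := Fin d → Fin 3)
    (ellNorm p fun v : S => ENNReal.ofReal |f v - g v|)
  rw [ellNorm_sigma hp (β := fun _ : Fin d → Fin 3 => S)
    (fun _ v => ENNReal.ofReal |f v - g v|)] at h₁
  simp only [Fintype.card_fun, Fintype.card_fin, Nat.cast_pow, Nat.cast_ofNat] at h₁
  refine le_trans ?_ h₁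
  -- Each cell is charged to its own copy of a voxel, with the copies labelled by the relative
  -- position.
  refine ellNorm_le_of_rel hp (fun σ x => x = ⟨position σ.1 (v σ).1, v σ⟩) ?_ fun σ _ =>
    ⟨_, rfl, ENNReal.ofReal_le_ofReal (hle σ)⟩
  rintro σ τ x rfl h
  simp only [Sigma.mk.injEq, heq_eq_eq] at h
  refine Subtype.ext (m.eq_of_position_eq (hv σ) (h.2 ▸ hv τ) ?_)
  rw [h.1, h.2]

end GrayscaleImage

end

theorem mainTheorem11 (𝕜 : Type*) [Field 𝕜] (d : ℕ) (S : Finset (Fin d → ℤ)) (f g : S → ℝ)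
    (method : GrayscaleImage.Method) (p : ℝ≥0∞) (hp : 1 ≤ p) :
    (∃ D, (method.function f).HasDiagram 𝕜 D) ∧
    (∃ E, (method.function g).HasDiagram 𝕜 E) ∧
    ∀ D E : ℕ → Barcode,
      (method.function f).HasDiagram 𝕜 D → (method.function g).HasDiagram 𝕜 E →
      totalWasserstein p D E ≤
        ENNReal.ofReal ((∑ i ∈ Finset.range (d + 1), (2 : ℝ) ^ (d - i) * (d.choose i : ℝ)) *
          ‖(WithLp.toLp p (f - g) : PiLp p fun _ : S => ℝ)‖) := by
  refine ⟨(method.function f).exists_hasDiagram 𝕜, (method.function g).exists_hasDiagram 𝕜,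
    fun D E hD hE => ?_⟩
  have h := (CubicalComplex.MonotoneFunction.close_of_hasDiagram hp hD hE).totalWasserstein_le hp
  refine (h.trans (method.ellNorm_function_sub_le hp f g)).trans ?_
  rw [sum_two_pow_mul_choose, ENNReal.ofReal_mul (by positivity),
    ENNReal.ofReal_pow (by norm_num), ENNReal.ofReal_ofNat]
  exact mul_le_mul_right (ellNorm_ofReal_le_norm hp f g) _
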